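/- Let $k$ be an algebraically closed field of characteristic $p\ge 3$, and let $(\mathfrak g,[p])$ be a finite-dimensional restricted Lie algebra over $k$. Let $\mathrm{Aut}_p(\mathfrak g)\subseteq GL(\mathfrak g)$ be the group of automorphisms of the restricted Lie algebra $\mathfrak g$, with its Zariski topology, and let $G:=\mathrm{Aut}_p(\mathfrak g)^\circ$ be the connected component of its identity. A torus of $\mathfrak g$ is an abelian restricted subalgebra all of whose elements $x$ are semisimple, i.e. $x$ lies in the span of $x^{[p]},x^{[p]^2},\dots$. Let $\mathfrak t\subseteq\mathfrak g$ be a torus whose dimension is maximal among all tori of $\mathfrak g$. Let $\mathcal T_{\mathfrak g}(k)$ be the set of injective homomorphisms of restricted Lie algebras $\mathfrak t\to\mathfrak g$, with the topology induced by the Zariski topology of $\mathrm{Hom}_k(\mathfrak t,\mathfrak g)$, and let $\mathcal X_{\mathfrak t}(k)$ be the irreducible component of $\mathcal T_{\mathfrak g}(k)$ containing the inclusion $\mathfrak t\hookrightarrow\mathfrak g$. The groups $\mathrm{Aut}_p(\mathfrak g)$ and $\mathrm{Aut}_p(\mathfrak t)$ act on $\mathcal T_{\mathfrak g}(k)$ by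 $g.\varphi=g\circ\varphi$ and $h.\varphi=\varphi\circ h^{-1}$. Let $S(\mathfrak g,\mathfrak t)$ be the stabilizer of the set $\mathcal X_{\mathfrak t}(k)$ in $\mathrm{Aut}_p(\mathfrak t)$. For $\varphi\in\mathcal X_{\mathfrak t}(k)$ let $S(\mathfrak g,\mathfrak t,\varphi)$ be the stabilizer in $S(\mathfrak g,\mathfrak t)$ of the closure, in $\mathcal X_{\mathfrak t}(k)$, of the orbit $G.\varphi$. Finally let $W(\mathfrak g,\varphi(\mathfrak t)):=N_G(\varphi(\mathfrak t))/C_G(\varphi(\mathfrak t))$, where $N_G(\varphi(\mathfrak t))=\{g\in G: g(\varphi(\mathfrak t))=\varphi(\mathfrak t)\}$ and $C_G(\varphi(\mathfrak t))=\{g\in G: g(x)=x \text{ for all } x\in\varphi(\mathfrak t)\}$. Theorem. For every $\varphi\in\mathcal X_{\mathfrak t}(k)$, the homomorphism $$\Theta_\varphi: N_G(\varphi(\mathfrak t))\to \mathrm{Aut}_p(\mathfrak t),\qquad g\mapsto\varphi^{-1}\circ g\circ\varphi,$$ induces a group isomorphism $W(\mathfrak g,\varphi(\mathfrak t))\cong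 S(\mathfrak g,\mathfrak t,\varphi)$. -/

import Mathlib

open scoped Pointwise

noncomputable section

/-! ### Restricted Lie algebras -/

section Restricted

variable (p : ℕ) (k : Type*) [Field k]

/-- Jacobson's expression `s₁(x, y) + ⋯ + s_{p-1}(x, y)`, where the `sᵢ` are determined by
`ad(x ⊗ X + y ⊗ 1)^(p-1) (x ⊗ 1) = ∑ᵢ i sᵢ(x, y) ⊗ X^(i-1)` in `L ⊗ k[X]`. The operator
`ad(x ⊗ X + y ⊗ 1)` is the polynomial `ad x · X + ad y` over `End(L)`; the summand with index `i`
below is `s_{i+1}(x, y)`. -/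
def jacobsonSum {L : Type*} [LieRing L] [LieAlgebra k L] (x y : L) : L :=
  ∑ i ∈ Finset.range (p - 1), ((i : k) + 1)⁻¹ •
    ((Polynomial.C (LieAlgebra.ad k L x) * Polynomial.X
      + Polynomial.C (LieAlgebra.ad k L y)) ^ (p - 1)).coeff i x

/-- A restricted Lie algebra over a field `k` of characteristic `p`: a Lie algebra with a
`p`-map `x ↦ x^[p]` satisfying Jacobson's three axioms. -/
class RestrictedLieAlgebra (L : Type*) [LieRing L] [LieAlgebra k L] where
  /-- the `p`-map `x ↦ x^[p]` -/
  pPow : L → L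
  ad_pPow : ∀ x : L, LieAlgebra.ad k L (pPow x) = LieAlgebra.ad k L x ^ p
  smul_pPow : ∀ (a : k) (x : L), pPow (a • x) = a ^ p • pPow x
  add_pPow : ∀ x y : L, pPow (x + y) = pPow x + pPow y + jacobsonSum p k x y

variable (L : Type*) [LieRing L] [LieAlgebra k L] [RestrictedLieAlgebra p k L]

/-- The `p`-map of a restricted Lie algebra. -/
def pPow {L : Type*} [LieRing L] [LieAlgebra k L] [RestrictedLieAlgebra p k L] (x : L) : L :=
  RestrictedLieAlgebra.pPow p k x

/-- A restricted subalgebra: a Lie subalgebra closed under the `p`-map. -/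
structure RestrictedSubalgebra extends LieSubalgebra k L where
  pPow_mem' : ∀ x ∈ toLieSubalgebra, pPow p k x ∈ toLieSubalgebra

variable {p k L}

theorem coe_coeff_ad_pow (t : LieSubalgebra k L) (x y : t) (n : ℕ) (i : ℕ) (z : t) :
    ((((Polynomial.C (LieAlgebra.ad k t x) * Polynomial.X
      + Polynomial.C (LieAlgebra.ad k t y)) ^ n).coeff i z : t) : L) =
    ((Polynomial.C (LieAlgebra.ad k L x) * Polynomial.X
      + Polynomial.C (LieAlgebra.ad k L y)) ^ n).coeff i (z : L) := by
  induction n generalizing i with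
  | zero =>
    simp only [pow_zero, Polynomial.coeff_one]
    split_ifs <;> simp
  | succ n ih =>
    cases i with
    | zero =>
      simp [pow_succ', add_mul, mul_assoc, ih]
    | succ i =>
      simp [pow_succ', add_mul, mul_assoc, Polynomial.coeff_C_mul, ih]

/-- A restricted subalgebra is a restricted Lie algebra under the restricted `p`-map. -/
instance (t : RestrictedSubalgebra p k L) : RestrictedLieAlgebra p k t.toLieSubalgebra where
  pPow x := ⟨pPow p k (x : L), t.pPow_mem' x x.2⟩
  ad_pPow x := by
    have key : ∀ (n : ℕ) (z : t.toLieSubalgebra),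
        (((LieAlgebra.ad k t.toLieSubalgebra x ^ n) z : t.toLieSubalgebra) : L)
          = (LieAlgebra.ad k L (x : L) ^ n) (z : L) := by
      intro n
      induction n with
      | zero => intro z; simp
      | succ n ih => intro z; simp [pow_succ, ih]
    ext z
    rw [key]
    exact LinearMap.congr_fun (RestrictedLieAlgebra.ad_pPow (p := p) (k := k) (x : L)) (z : L)
  smul_pPow a x := Subtype.ext (RestrictedLieAlgebra.smul_pPow (p := p) a (x : L))
  add_pPow x y := by
    apply Subtype.ext
    refine (RestrictedLieAlgebra.add_pPow (p := p) (k := k) (x : L) (y : L)).trans ?_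
    simp [jacobsonSum, coe_coeff_ad_pow, pPow]

theorem coe_pPow (t : RestrictedSubalgebra p k L) (x : t.toLieSubalgebra) :
    ((pPow p k x : t.toLieSubalgebra) : L) = pPow p k (x : L) := rfl

variable (p k) in
/-- `x` is semisimple if it lies in the restricted subalgebra generated by `x^[p]`, i.e. in the
span of `x^[p], x^[p]^2, …`. -/
def IsSemisimpleElement (x : L) : Prop :=
  x ∈ Submodule.span k (Set.range fun i : ℕ => (pPow p k)^[i + 1] x)

namespace RestrictedSubalgebra

/-- A torus is an abelian restricted subalgebra all of whose elements are semisimple. -/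
def IsTorus (t : RestrictedSubalgebra p k L) : Prop :=
  (∀ x ∈ t.toLieSubalgebra, ∀ y ∈ t.toLieSubalgebra, ⁅x, y⁆ = 0) ∧
    ∀ x ∈ t.toLieSubalgebra, IsSemisimpleElement p k x

/-- `t ∈ Tor(L)`: a torus whose dimension is maximal among all tori of `L`. -/
def IsTorusOfMaximalDim (t : RestrictedSubalgebra p k L) : Prop :=
  t.IsTorus ∧ ∀ s : RestrictedSubalgebra p k L, s.IsTorus →
    Module.finrank k s.toLieSubalgebra ≤ Module.finrank k t.toLieSubalgebra

end RestrictedSubalgebra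

end Restricted

/-! ### The Zariski topology on a finite-dimensional vector space -/

section Zariski

variable (k : Type*) [Field k]

/-- The algebra of polynomial functions on `V`: it is generated by the linear forms. -/
def polyFunctions (V : Type*) [AddCommGroup V] [Module k V] : Subalgebra k (V → k) :=
  Algebra.adjoin k (Set.range fun f : Module.Dual k V => (f : V → k))

/-- The Zariski topology: the sets `{v | f v ≠ 0}`, `f` a polynomial function, form a basis. -/
abbrev zariskiTopology (V : Type*) [AddCommGroup V] [Module k V] : TopologicalSpace V :=
  TopologicalSpace.generateFrom {U | ∃ f ∈ polyFunctions k V, U = {v | f v ≠ 0}}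

variable {k}

theorem polyFunctions_comp {V W : Type*} [AddCommGroup V] [Module k V] [AddCommGroup W]
    [Module k W] (T : V →ₗ[k] W) {f : W → k} (hf : f ∈ polyFunctions k W) :
    f ∘ T ∈ polyFunctions k V := by
  induction hf using Algebra.adjoin_induction with
  | mem f hf =>
    obtain ⟨l, rfl⟩ := hf
    exact Algebra.subset_adjoin ⟨l.comp T, rfl⟩
  | algebraMap r => exact (polyFunctions k V).algebraMap_mem r
  | add f g _ _ h₁ h₂ => exact (polyFunctions k V).add_mem h₁ h₂
  | mul f g _ _ h₁ h₂ => exact (polyFunctions k V).mul_mem h₁ h₂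

theorem continuous_zariski {V W : Type*} [AddCommGroup V] [Module k V] [AddCommGroup W]
    [Module k W] (T : V →ₗ[k] W) :
    @Continuous V W (zariskiTopology k V) (zariskiTopology k W) T := by
  let := zariskiTopology k V
  refine (continuous_generateFrom_iff (f := T)).2 ?_
  rintro U ⟨f, hf, rfl⟩
  exact TopologicalSpace.isOpen_generateFrom_of_mem ⟨f ∘ T, polyFunctions_comp T hf, rfl⟩

end Zariski

/-! ### The automorphism group and its identity component -/

section Aut

variable (p : ℕ) (k : Type*) [Field k]
variable (L : Type*) [LieRing L] [LieAlgebra k L] [RestrictedLieAlgebra p k L]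

/-- `Aut_p(L)`: the group of automorphisms of the restricted Lie algebra `L`. -/
def AutP : Subgroup (L ≃ₗ[k] L) where
  carrier := {g | (∀ x y, g ⁅x, y⁆ = ⁅g x, g y⁆) ∧ ∀ x, g (pPow p k x) = pPow p k (g x)}
  mul_mem' {a b} ha hb := ⟨fun x y => by simp [hb.1, ha.1], fun x => by simp [hb.2, ha.2]⟩
  one_mem' := ⟨fun _ _ => rfl, fun _ => rfl⟩
  inv_mem' {a} ha := by
    have e : ∀ z, a (a⁻¹ z) = z := a.apply_symm_apply
    refine ⟨fun x y => a.injective ?_, fun x => a.injective ?_⟩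
    · rw [e, ha.1, e, e]
    · rw [e, ha.2, e]

/-- The Zariski topology on `Aut_p(L) ⊆ GL(L) ⊆ End(L)`. (`GL(L)` is the principal open subset
`det ≠ 0` of `End(L)`, so its topology as an affine variety is the induced one.) -/
instance : TopologicalSpace (AutP p k L) :=
  TopologicalSpace.induced (fun g => ((g : L ≃ₗ[k] L) : L →ₗ[k] L)) (zariskiTopology k (L →ₗ[k] L))

variable {p k L} in
theorem AutP.continuous_mul_left (g : AutP p k L) :
    Continuous (fun h : AutP p k L => g * h) := by
  let : TopologicalSpace (L →ₗ[k] L) := zariskiTopology k (L →ₗ[k] L)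
  have h₀ : Continuous (fun h : AutP p k L => ((h : L ≃ₗ[k] L) : L →ₗ[k] L)) :=
    continuous_induced_dom
  refine continuous_induced_rng.2 ?_
  exact (continuous_zariski (LinearMap.llcomp k L L L ((g : L ≃ₗ[k] L) : L →ₗ[k] L))).comp h₀

/-- `G = Aut_p(L)°`: the connected component of the identity in `Aut_p(L)`. -/
def AutPConn : Subgroup (AutP p k L) where
  carrier := connectedComponent 1
  one_mem' := mem_connectedComponent
  mul_mem' {a b} ha hb := by
    have h := (isPreconnected_connectedComponent (x := (1 : AutP p k L))).image _
      (AutP.continuous_mul_left a).continuousOn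
    have h2 := h.subset_connectedComponent (x := a) ⟨1, mem_connectedComponent, mul_one a⟩
    rw [← connectedComponent_eq ha] at h2
    exact h2 ⟨b, hb, rfl⟩
  inv_mem' {a} ha := by
    have h := (isPreconnected_connectedComponent (x := (1 : AutP p k L))).image _
      (AutP.continuous_mul_left a⁻¹).continuousOn
    exact h.subset_connectedComponent (x := 1) ⟨a, ha, inv_mul_cancel a⟩
      ⟨1, mem_connectedComponent, mul_one _⟩

variable {L}

/-- `N_G(s) = {g ∈ G | g(s) = s}` for a subspace `s` of `L`. -/
def normalizerG (s : Submodule k L) : Subgroup (AutPConn p k L) where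
  carrier := {g | s.map (((g : AutP p k L) : L ≃ₗ[k] L) : L →ₗ[k] L) = s}
  one_mem' := Submodule.map_id s
  mul_mem' {a b} ha hb := by
    refine (Submodule.map_comp _ _ s).trans ?_
    rw [hb]
    exact ha
  inv_mem' {a} ha := by
    have ha' : s.map (((a : AutP p k L) : L ≃ₗ[k] L) : L →ₗ[k] L) = s := ha
    have e : ∀ z, (((a⁻¹ : AutPConn p k L) : AutP p k L) : L ≃ₗ[k] L)
        (((a : AutP p k L) : L ≃ₗ[k] L) z) = z :=
      fun z => ((a : AutP p k L) : L ≃ₗ[k] L).symm_apply_apply z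
    change s.map ((((a⁻¹ : AutPConn p k L) : AutP p k L) : L ≃ₗ[k] L) : L →ₗ[k] L) = s
    conv_lhs => rw [← ha']
    rw [← Submodule.map_comp]
    convert Submodule.map_id s
    ext z
    exact e z

/-- `C_G(s) = {g ∈ G | g(x) = x for all x ∈ s}`. -/
def centralizerG (s : Submodule k L) : Subgroup (AutPConn p k L) where
  carrier := {g | ∀ x ∈ s, ((g : AutP p k L) : L ≃ₗ[k] L) x = x}
  one_mem' _ _ := rfl
  mul_mem' {a b} ha hb x hx := by
    change ((a : AutP p k L) : L ≃ₗ[k] L) (((b : AutP p k L) : L ≃ₗ[k] L) x) = x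
    rw [hb x hx, ha x hx]
  inv_mem' {a} ha x hx := by
    apply ((a : AutP p k L) : L ≃ₗ[k] L).injective
    rw [ha x hx]
    exact ((a : AutP p k L) : L ≃ₗ[k] L).apply_symm_apply x

instance (s : Submodule k L) : ((centralizerG p k s).subgroupOf (normalizerG p k s)).Normal where
  conj_mem c hc n := by
    intro x hx
    have hn : x ∈ s.map (((n : AutPConn p k L) : AutP p k L) : L ≃ₗ[k] L).toLinearMap := by
      rw [show s.map _ = s from n.2]; exact hx
    obtain ⟨y, hy, rfl⟩ := hn
    have e : ∀ z, ((((n⁻¹ : normalizerG p k s) : AutPConn p k L) : AutP p k L) : L ≃ₗ[k] L)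
        ((((n : AutPConn p k L) : AutP p k L) : L ≃ₗ[k] L) z) = z :=
      fun z => ((((n : AutPConn p k L) : AutP p k L) : L ≃ₗ[k] L)).symm_apply_apply z
    change (((n : AutPConn p k L) : AutP p k L) : L ≃ₗ[k] L)
      ((((c : AutPConn p k L) : AutP p k L) : L ≃ₗ[k] L)
        (((((n⁻¹ : normalizerG p k s) : AutPConn p k L) : AutP p k L) : L ≃ₗ[k] L)
          ((((n : AutPConn p k L) : AutP p k L) : L ≃ₗ[k] L) y))) = _
    rw [e]
    exact congrArg _ (hc y hy)

/-- The Weyl group `W(L, s) = N_G(s) / C_G(s)`. -/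
abbrev WeylGroup (s : Submodule k L) : Type _ :=
  normalizerG p k s ⧸ (centralizerG p k s).subgroupOf (normalizerG p k s)

end Aut

/-! ### The scheme of embeddings of a torus -/

section TorusScheme

variable {p : ℕ} {k : Type*} [Field k]
variable {L : Type*} [LieRing L] [LieAlgebra k L] [RestrictedLieAlgebra p k L]

/-- The set of `k`-points `𝒯(k)` of the torus scheme: the injective homomorphisms of restricted Lie
algebras `t → L`. -/
structure TorusPoint (t : RestrictedSubalgebra p k L) extends t.toLieSubalgebra →ₗ⁅k⁆ L where
  injective' : Function.Injective toLieHom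
  map_pPow' : ∀ x, toLieHom (pPow p k x) = pPow p k (toLieHom x)

variable {t : RestrictedSubalgebra p k L}

namespace TorusPoint

theorem ext' {φ ψ : TorusPoint t} (h : ∀ x, φ.toLieHom x = ψ.toLieHom x) : φ = ψ := by
  cases φ; cases ψ; congr; exact LieHom.ext h

variable (t) in
/-- The given embedding `t ↪ L`. -/
def incl : TorusPoint t where
  toLieHom := t.toLieSubalgebra.incl
  injective' := Subtype.val_injective
  map_pPow' _ := rfl

/-- The Zariski topology on `𝒯(k)`, a locally closed subset of the vector space `Hom_k(t, L)`. -/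
instance : TopologicalSpace (TorusPoint t) :=
  TopologicalSpace.induced (fun φ => (φ.toLieHom : t.toLieSubalgebra →ₗ[k] L))
    (zariskiTopology k (t.toLieSubalgebra →ₗ[k] L))

/-- The action `g • φ = g ∘ φ` of `Aut_p(L)` on `𝒯(k)`. -/
instance : MulAction (AutP p k L) (TorusPoint t) where
  smul g φ :=
    { toLinearMap := (((g : L ≃ₗ[k] L) : L →ₗ[k] L)).comp (φ.toLieHom : _ →ₗ[k] L)
      map_lie' := fun {x y} => by
        change (g : L ≃ₗ[k] L) (φ.toLieHom ⁅x, y⁆) = _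
        rw [LieHom.map_lie, g.2.1]
        rfl
      injective' := (g : L ≃ₗ[k] L).injective.comp φ.injective'
      map_pPow' := fun x => by
        change (g : L ≃ₗ[k] L) (φ.toLieHom (pPow p k x)) = _
        rw [φ.map_pPow', g.2.2]
        rfl }
  one_smul _ := ext' fun _ => rfl
  mul_smul _ _ _ := ext' fun _ => rfl

/-- The action `h • φ = φ ∘ h⁻¹` of `Aut_p(t)` on `𝒯(k)`. -/
instance : MulAction (AutP p k t.toLieSubalgebra) (TorusPoint t) where
  smul h φ :=
    { toLinearMap := (φ.toLieHom : _ →ₗ[k] L).comp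
        ((h⁻¹ : AutP p k t.toLieSubalgebra) : t.toLieSubalgebra ≃ₗ[k] t.toLieSubalgebra).toLinearMap
      map_lie' := fun {x y} => by
        change φ.toLieHom (((h⁻¹ : AutP p k t.toLieSubalgebra) :
          t.toLieSubalgebra ≃ₗ[k] t.toLieSubalgebra) ⁅x, y⁆) = _
        rw [h⁻¹.2.1, LieHom.map_lie]
        rfl
      injective' := φ.injective'.comp
        ((h⁻¹ : AutP p k t.toLieSubalgebra) :
          t.toLieSubalgebra ≃ₗ[k] t.toLieSubalgebra).injective
      map_pPow' := fun x => by
        change φ.toLieHom (((h⁻¹ : AutP p k t.toLieSubalgebra) :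
          t.toLieSubalgebra ≃ₗ[k] t.toLieSubalgebra) (pPow p k x)) = _
        rw [h⁻¹.2.2, φ.map_pPow']
        rfl }
  one_smul φ := ext' fun x => by
    change φ.toLieHom (((1⁻¹ : AutP p k t.toLieSubalgebra) :
      t.toLieSubalgebra ≃ₗ[k] t.toLieSubalgebra) x) = _
    rw [inv_one]; rfl
  mul_smul a b φ := ext' fun x => by
    change φ.toLieHom ((((a * b)⁻¹ : AutP p k t.toLieSubalgebra) :
      t.toLieSubalgebra ≃ₗ[k] t.toLieSubalgebra) x) = _
    rw [mul_inv_rev]; rfl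

/-- The image `φ(t)`. -/
def image (φ : TorusPoint t) : Submodule k L := LinearMap.range (φ.toLieHom : t.toLieSubalgebra →ₗ[k] L)

end TorusPoint

variable (t) in
/-- `𝒳_t(k)`: the irreducible component of `𝒯(k)` containing the given embedding `t ↪ L`. -/
def torusComponent : Set (TorusPoint t) := irreducibleComponent (TorusPoint.incl t)

variable (t) in
/-- The toral stabilizer `S(L, t)`: the stabilizer of `𝒳_t(k)` in `Aut_p(t)`. -/
def toralStabilizer : Subgroup (AutP p k t.toLieSubalgebra) :=
  MulAction.stabilizer (AutP p k t.toLieSubalgebra) (torusComponent t)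

/-- The closure of the `G`-orbit `G • φ` in `𝒳_t(k)`, viewed as a subset of `𝒯(k)`. -/
def orbitClosure (φ : TorusPoint t) : Set (TorusPoint t) :=
  Subtype.val '' closure
    {ψ : torusComponent t | (ψ : TorusPoint t) ∈ MulAction.orbit (AutPConn p k L) φ}

/-- `S(L, t, φ)`: the stabilizer of the orbit closure of `φ` in `S(L, t)`. -/
def orbitClosureStabilizer (φ : TorusPoint t) : Subgroup (toralStabilizer t) :=
  MulAction.stabilizer (toralStabilizer t) (orbitClosure φ)

namespace TorusPoint

/-- `φ` as an isomorphism of `t` onto `φ(t)`. -/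
def equivImage (φ : TorusPoint t) : t.toLieSubalgebra ≃ₗ[k] φ.image :=
  LinearEquiv.ofInjective (φ.toLieHom : t.toLieSubalgebra →ₗ[k] L) φ.injective'

theorem apply_equivImage_symm (φ : TorusPoint t) (z : φ.image) :
    φ.toLieHom (φ.equivImage.symm z) = z :=
  congrArg Subtype.val (φ.equivImage.apply_symm_apply z)

theorem normalizer_apply_mem (φ : TorusPoint t) (n : normalizerG p k φ.image)
    (x : t.toLieSubalgebra) :
    (((n : AutPConn p k L) : AutP p k L) : L ≃ₗ[k] L) (φ.toLieHom x) ∈ φ.image := by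
  have h : φ.image.map (((n : AutPConn p k L) : AutP p k L) : L ≃ₗ[k] L).toLinearMap = φ.image :=
    n.2
  exact h.le ⟨φ.toLieHom x, ⟨x, rfl⟩, rfl⟩

/-- The map `φ⁻¹ ∘ g ∘ φ : t → t` for `g ∈ N_G(φ(t))`. -/
def conj (φ : TorusPoint t) (n : normalizerG p k φ.image) (x : t.toLieSubalgebra) :
    t.toLieSubalgebra :=
  φ.equivImage.symm ⟨_, φ.normalizer_apply_mem n x⟩

theorem apply_conj (φ : TorusPoint t) (n : normalizerG p k φ.image) (x : t.toLieSubalgebra) :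
    φ.toLieHom (φ.conj n x) =
      (((n : AutPConn p k L) : AutP p k L) : L ≃ₗ[k] L) (φ.toLieHom x) :=
  φ.apply_equivImage_symm _

theorem conj_one (φ : TorusPoint t) (x : t.toLieSubalgebra) : φ.conj 1 x = x :=
  φ.injective' (φ.apply_conj 1 x)

theorem conj_mul (φ : TorusPoint t) (m n : normalizerG p k φ.image) (x : t.toLieSubalgebra) :
    φ.conj (m * n) x = φ.conj m (φ.conj n x) := by
  apply φ.injective'
  rw [apply_conj, apply_conj, apply_conj]
  rfl

/-- The homomorphism `Θ_φ : N_G(φ(t)) → Aut_p(t)`, `g ↦ φ⁻¹ ∘ g ∘ φ`. -/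
def theta (φ : TorusPoint t) : normalizerG p k φ.image →* AutP p k t.toLieSubalgebra where
  toFun n :=
    ⟨{ toFun := φ.conj n
       invFun := φ.conj n⁻¹
       left_inv := fun x => by rw [← conj_mul, inv_mul_cancel, conj_one]
       right_inv := fun x => by rw [← conj_mul, mul_inv_cancel, conj_one]
       map_add' := fun x y => φ.injective' (by simp [apply_conj])
       map_smul' := fun a x => φ.injective' (by simp [apply_conj]) },
      by
        refine ⟨fun x y => φ.injective' ?_, fun x => φ.injective' ?_⟩
        · change φ.toLieHom (φ.conj n ⁅x, y⁆) = φ.toLieHom ⁅φ.conj n x, φ.conj n y⁆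
          rw [apply_conj, LieHom.map_lie, LieHom.map_lie, apply_conj, apply_conj,
            (n : AutPConn p k L).1.2.1]
        · change φ.toLieHom (φ.conj n (pPow p k x)) = φ.toLieHom (pPow p k (φ.conj n x))
          rw [apply_conj, φ.map_pPow', φ.map_pPow', apply_conj, (n : AutPConn p k L).1.2.2]⟩
  map_one' := by
    apply Subtype.ext
    ext x
    exact congrArg Subtype.val (φ.conj_one x)
  map_mul' m n := by
    apply Subtype.ext
    ext x
    exact congrArg Subtype.val (φ.conj_mul m n x)

end TorusPoint

end TorusScheme

end

noncomputable section

/-! ### Polynomial functions -/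

section PolynomialFunctions

variable {k : Type*} [Field k] {V W : Type*} [AddCommGroup V] [Module k V] [AddCommGroup W]
  [Module k W]

/-! The two actions on embeddings commute, and for `g` normalizing the image of `φ` one has `Θ(g)⁻¹
• φ = g • φ` (`TorusPoint.theta_inv_smul`). Hence `Θ(g)` preserves the closure of `G • φ`, and its
kernel is the centralizer. Two points need an argument: that `Θ(g)` preserves the component of the
inclusion, and that every stabilizing `h` has the form `Θ(g)`.

For the first, the connected group `G` fixes each irreducible component, so `Θ(g)⁻¹` carries the
component to one that still meets it in `g • φ`. It is therefore enough that only one irreducible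
component passes through each embedding (`eq_of_mem_irreducibleComponents_torusPoint`). A torus is
generated by one element `h` subject to a `p`-polynomial relation `P(h) = 0` with nonzero linear
coefficient (`exists_cyclic_vector`), so near `φ` embeddings correspond to zeros of `P` in `L`. The
derivative of `P` is an invertible scalar, up to terms of order at least two. A Newton step `x ↦ x -
c₀⁻¹ P(x)` sends the ideal `J` of the coordinates of `P` into `J²`; iterating it and applying
Krull's intersection theorem makes the zero set locally irreducible
(`pPoly_zeros_locally_irreducible`).

For the second, if `h` fixes the closure of `G • φ`, then `G • φ` and `G • (h⁻¹ • φ)` have the same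
closure. By Chevalley's theorem an orbit contains a nonempty open subset of its closure, so the two
orbits agree (`mem_orbit_of_closure_orbit_eq`). Writing `g • φ = h⁻¹ • φ` gives `g ∘ φ = φ ∘ h`,
which says that `g` normalizes the image and `Θ(g) = h`. -/

theorem dual_mem_polyFunctions (f : Module.Dual k V) : (f : V → k) ∈ polyFunctions k V :=
  Algebra.subset_adjoin ⟨f, rfl⟩

theorem const_mem_polyFunctions (c : k) : (fun _ : V => c) ∈ polyFunctions k V :=
  (polyFunctions k V).algebraMap_mem c

/-- The linear form `f` as an element of the algebra of polynomial functions. -/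
def polyLinear (f : Module.Dual k V) : polyFunctions k V := ⟨f, dual_mem_polyFunctions f⟩

/-- Evaluation of polynomial functions at a point. -/
def polyEval (v : V) : polyFunctions k V →ₐ[k] k :=
  (Pi.evalAlgHom k (fun _ : V => k) v).comp (polyFunctions k V).val

@[simp] theorem polyEval_apply (v : V) (f : polyFunctions k V) : polyEval v f = (f : V → k) v := rfl

theorem polyFunctions_algHom_ext {A : Type*} [Semiring A] [Algebra k A]
    {φ ψ : polyFunctions k V →ₐ[k] A} (h : ∀ f, φ (polyLinear f) = ψ (polyLinear f)) : φ = ψ := by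
  refine AlgHom.ext fun ⟨f, hf⟩ => ?_
  induction hf using Algebra.adjoin_induction with
  | mem f hf =>
    obtain ⟨l, rfl⟩ := hf
    exact h l
  | algebraMap r => exact (φ.commutes r).trans (ψ.commutes r).symm
  | add f g hf hg h₁ h₂ =>
    exact (map_add φ ⟨f, hf⟩ ⟨g, hg⟩).trans ((congrArg₂ _ h₁ h₂).trans (map_add ψ _ _).symm)
  | mul f g hf hg h₁ h₂ =>
    exact (map_mul φ ⟨f, hf⟩ ⟨g, hg⟩).trans ((congrArg₂ _ h₁ h₂).trans (map_mul ψ _ _).symm)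

/-- Restricting `φ` to linear forms gives an element of the bidual, which in finite dimension is
evaluation at a vector. -/
theorem eq_polyEval [Module.Finite k V] (φ : polyFunctions k V →ₐ[k] k) : ∃ v, φ = polyEval v := by
  let ξ : Module.Dual k (Module.Dual k V) :=
    { toFun := fun f => φ (polyLinear f)
      map_add' := fun f g => (map_add φ (polyLinear f) (polyLinear g))
      map_smul' := fun c f => (map_smul φ c (polyLinear f)) }
  refine ⟨(Module.evalEquiv k V).symm ξ, polyFunctions_algHom_ext fun f => ?_⟩
  change ξ f = f ((Module.evalEquiv k V).symm ξ)
  simp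

/-- A map between vector spaces is polynomial if its composites with linear forms are. -/
def IsPolyMap (k : Type*) [Field k] {V W : Type*} [AddCommGroup V] [Module k V] [AddCommGroup W]
    [Module k W] (F : V → W) : Prop :=
  ∀ f : Module.Dual k W, f ∘ F ∈ polyFunctions k V

theorem IsPolyMap.comp_mem {F : V → W} (hF : IsPolyMap k F) {f : W → k}
    (hf : f ∈ polyFunctions k W) : f ∘ F ∈ polyFunctions k V := by
  induction hf using Algebra.adjoin_induction with
  | mem f hf =>
    obtain ⟨l, rfl⟩ := hf
    exact hF l
  | algebraMap r => exact (polyFunctions k V).algebraMap_mem r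
  | add f g _ _ h₁ h₂ => exact (polyFunctions k V).add_mem h₁ h₂
  | mul f g _ _ h₁ h₂ => exact (polyFunctions k V).mul_mem h₁ h₂

theorem IsPolyMap.comp {U : Type*} [AddCommGroup U] [Module k U] {F : V → W} {E : U → V}
    (hF : IsPolyMap k F) (hE : IsPolyMap k E) : IsPolyMap k (F ∘ E) :=
  fun f => hE.comp_mem (hF f)

theorem LinearMap.isPolyMap (T : V →ₗ[k] W) : IsPolyMap k T :=
  fun f => polyFunctions_comp T (dual_mem_polyFunctions f)

theorem isPolyMap_const (w : W) : IsPolyMap k (fun _ : V => w) :=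
  fun f => const_mem_polyFunctions (f w)

theorem IsPolyMap.add {F E : V → W} (hF : IsPolyMap k F) (hE : IsPolyMap k E) :
    IsPolyMap k (fun v => F v + E v) := fun f => by
  convert (polyFunctions k V).add_mem (hF f) (hE f) using 1
  ext v; simp

theorem IsPolyMap.smul {a : V → k} {F : V → W} (ha : a ∈ polyFunctions k V) (hF : IsPolyMap k F) :
    IsPolyMap k (fun v => a v • F v) := fun f => by
  convert (polyFunctions k V).mul_mem ha (hF f) using 1
  ext v; simp

theorem IsPolyMap.const_smul (c : k) {F : V → W} (hF : IsPolyMap k F) :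
    IsPolyMap k (fun v => c • F v) :=
  IsPolyMap.smul (const_mem_polyFunctions c) hF

theorem IsPolyMap.sum {ι : Type*} (s : Finset ι) {F : ι → V → W}
    (hF : ∀ i ∈ s, IsPolyMap k (F i)) : IsPolyMap k (fun v => ∑ i ∈ s, F i v) := fun f => by
  have := (polyFunctions k V).sum_mem (fun i hi => hF i hi f)
  convert this using 1
  ext v; simp

/-- Pullback of polynomial functions along a polynomial map. -/
def IsPolyMap.comap {F : V → W} (hF : IsPolyMap k F) : polyFunctions k W →ₐ[k] polyFunctions k V where
  toFun f := ⟨f ∘ F, hF.comp_mem f.2⟩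
  map_one' := rfl
  map_mul' _ _ := rfl
  map_zero' := rfl
  map_add' _ _ := rfl
  commutes' _ := rfl

@[simp] theorem IsPolyMap.comap_apply {F : V → W} (hF : IsPolyMap k F) (f : polyFunctions k W) (v : V) :
    (hF.comap f : V → k) v = (f : W → k) (F v) := rfl

theorem det_mem_polyFunctions [Module.Finite k V] (A : W → V →ₗ[k] V) (hA : IsPolyMap k A) :
    (fun w => LinearMap.det (A w)) ∈ polyFunctions k W := by
  let b := Module.finBasis k V
  have : (fun w => LinearMap.det (A w)) = ∑ σ : Equiv.Perm (Fin (Module.finrank k V)),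
      algebraMap k (W → k) (Equiv.Perm.sign σ : ℤ) *
        ∏ i, (fun w => b.coord (σ i) (A w (b i))) := by
    ext w
    rw [← LinearMap.det_toMatrix b, Matrix.det_apply']
    simp [LinearMap.toMatrix_apply]
  rw [this]
  refine sum_mem fun σ _ => mul_mem (Subalgebra.algebraMap_mem _ _) (prod_mem fun i _ => ?_)
  exact hA ((b.coord (σ i)).comp (LinearMap.applyₗ (b i)))

/-! ### Coordinates -/

variable [Module.Finite k V]

/-- The algebra of polynomial functions as a quotient of a polynomial ring, by coordinates
centred at `x`. -/
def coordHom (x : V) : MvPolynomial (Fin (Module.finrank k V)) k →ₐ[k] polyFunctions k V :=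
  MvPolynomial.aeval fun i => polyLinear ((Module.finBasis k V).coord i)
    - algebraMap k _ ((Module.finBasis k V).coord i x)

theorem coordHom_apply (x v : V) (q : MvPolynomial (Fin (Module.finrank k V)) k) :
    (coordHom x q : V → k) v = MvPolynomial.eval (fun i => (Module.finBasis k V).repr (v - x) i) q := by
  have : (polyEval v).comp (coordHom x) =
      MvPolynomial.aeval (fun i => (Module.finBasis k V).repr (v - x) i) := by
    ext i
    simp [coordHom, polyLinear]
  have h := DFunLike.congr_fun this q
  rw [MvPolynomial.aeval_eq_eval] at h
  exact h

theorem coordHom_surjective (x : V) : Function.Surjective (coordHom (k := k) x) := by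
  rw [← AlgHom.range_eq_top, eq_top_iff]
  rintro ⟨f, hf⟩ -
  induction hf using Algebra.adjoin_induction with
  | mem f hf =>
    obtain ⟨l, rfl⟩ := hf
    refine ⟨∑ i, MvPolynomial.C (l (Module.finBasis k V i)) * MvPolynomial.X i
      + MvPolynomial.C (l x), ?_⟩
    ext v
    refine Eq.trans ?_ (Eq.refl (l v))
    refine (coordHom_apply x v _).trans ?_
    have := congrArg l ((Module.finBasis k V).sum_repr (v - x))
    simp only [map_sum, map_smul, map_sub, smul_eq_mul] at this
    simp only [map_add, map_sum, map_mul, MvPolynomial.eval_C, MvPolynomial.eval_X]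
    simp only [map_sub]
    rw [← eq_sub_iff_add_eq, ← this]
    exact Finset.sum_congr rfl fun i _ => mul_comm _ _
  | algebraMap r => exact Subalgebra.algebraMap_mem _ r
  | add f g _ _ h₁ h₂ => exact add_mem h₁ h₂
  | mul f g _ _ h₁ h₂ => exact mul_mem h₁ h₂

instance : Algebra.FiniteType k (polyFunctions k V) :=
  Algebra.FiniteType.of_surjective (coordHom (0 : V)) (coordHom_surjective 0)

instance : IsNoetherianRing (polyFunctions k V) :=
  Algebra.FiniteType.isNoetherianRing k _

theorem coordHom_injective [Infinite k] (x : V) : Function.Injective (coordHom (k := k) x) := by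
  rw [injective_iff_map_eq_zero]
  intro q hq
  refine MvPolynomial.funext fun a => ?_
  have h := coordHom_apply x ((Module.finBasis k V).equivFun.symm a + x) q
  have e : (fun i => (Module.finBasis k V).repr
      ((Module.finBasis k V).equivFun.symm a + x - x) i) = a := by
    ext i
    rw [add_sub_cancel_right, ← Module.Basis.equivFun_apply, LinearEquiv.apply_symm_apply]
  rw [hq, e] at h
  exact h.symm

end PolynomialFunctions

/-! ### The Zariski topology -/

section ZariskiTopology

open TopologicalSpace

variable {k : Type*} [Field k] {V W : Type*} [AddCommGroup V] [Module k V] [AddCommGroup W]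
  [Module k W]

theorem isTopologicalBasis_zariski :
    @IsTopologicalBasis V (zariskiTopology k V)
      {U | ∃ f ∈ polyFunctions k V, U = {v | f v ≠ 0}} := by
  let := zariskiTopology k V
  refine ⟨?_, ?_, rfl⟩
  · rintro _ ⟨f, hf, rfl⟩ _ ⟨g, hg, rfl⟩ v hv
    refine ⟨_, ⟨f * g, mul_mem hf hg, rfl⟩, ?_, ?_⟩
    · simpa using hv
    · intro w hw
      simpa using hw
  · rw [Set.sUnion_eq_univ_iff]
    intro v
    exact ⟨_, ⟨1, one_mem _, rfl⟩, one_ne_zero⟩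

/-- Sending a point to its maximal ideal lets `V` inherit noetherianity from the prime spectrum. -/
theorem zariskiTopology_eq_induced : zariskiTopology k V = TopologicalSpace.induced
    (fun v => (⟨RingHom.ker (polyEval v), RingHom.ker_isPrime (polyEval v)⟩ :
      PrimeSpectrum (polyFunctions k V))) inferInstance := by
  rw [PrimeSpectrum.isTopologicalBasis_basic_opens.eq_generateFrom, induced_generateFrom_eq]
  refine congrArg generateFrom (Set.ext fun U => ?_)
  constructor
  · rintro ⟨f, hf, rfl⟩
    exact ⟨_, ⟨⟨f, hf⟩, rfl⟩, rfl⟩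
  · rintro ⟨_, ⟨f, rfl⟩, rfl⟩
    exact ⟨f, f.2, rfl⟩

theorem noetherianSpace_zariski [Module.Finite k V] :
    @NoetherianSpace V (zariskiTopology k V) := by
  let := zariskiTopology k V
  exact (Topology.IsInducing.mk zariskiTopology_eq_induced).noetherianSpace

theorem noetherianSpace_induced_zariski [Module.Finite k V] {X : Type*} (i : X → V) :
    @NoetherianSpace X (TopologicalSpace.induced i (zariskiTopology k V)) := by
  let := zariskiTopology k V
  let := TopologicalSpace.induced i (zariskiTopology k V)
  have := noetherianSpace_zariski (k := k) (V := V)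
  exact (Topology.IsInducing.mk rfl : Topology.IsInducing i).noetherianSpace

section Induced

variable {X : Type*} [tX : TopologicalSpace X] {i : X → V}

theorem isOpen_iff_of_induced_zariski
    (hX : tX = TopologicalSpace.induced i (zariskiTopology k V)) {U : Set X} :
    IsOpen U ↔ ∀ x ∈ U, ∃ f ∈ polyFunctions k V, f (i x) ≠ 0 ∧ ∀ y, f (i y) ≠ 0 → y ∈ U := by
  let := zariskiTopology k V
  have h := (isTopologicalBasis_zariski (k := k) (V := V)).isInducing
    (Topology.IsInducing.mk hX : Topology.IsInducing i)
  rw [h.isOpen_iff]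
  refine forall₂_congr fun x hx => ?_
  constructor
  · rintro ⟨_, ⟨_, ⟨f, hf, rfl⟩, rfl⟩, hx, hU⟩
    exact ⟨f, hf, hx, hU⟩
  · rintro ⟨f, hf, hx, hU⟩
    exact ⟨_, ⟨_, ⟨f, hf, rfl⟩, rfl⟩, hx, hU⟩

theorem isOpen_ne_of_induced_zariski
    (hX : tX = TopologicalSpace.induced i (zariskiTopology k V)) {f : V → k} (hf : f ∈ polyFunctions k V) :
    IsOpen {x | f (i x) ≠ 0} :=
  (isOpen_iff_of_induced_zariski hX).2 fun _ hx => ⟨f, hf, hx, fun _ hy => hy⟩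

theorem mem_closure_iff_of_induced_zariski
    (hX : tX = TopologicalSpace.induced i (zariskiTopology k V)) {S : Set X} {x : X} :
    x ∈ closure S ↔ ∀ f ∈ polyFunctions k V, (∀ y ∈ S, f (i y) = 0) → f (i x) = 0 := by
  rw [mem_closure_iff]
  constructor
  · intro h f hf hS
    by_contra hx
    obtain ⟨y, hy, hyS⟩ := h _ (isOpen_ne_of_induced_zariski hX hf) hx
    exact hy (hS y hyS)
  · intro h U hU hx
    obtain ⟨f, hf, hfx, hfU⟩ := (isOpen_iff_of_induced_zariski hX).1 hU x hx
    by_contra hne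
    refine hfx (h f hf fun y hy => ?_)
    by_contra hfy
    exact hne ⟨y, hfU y hfy, hy⟩

end Induced

end ZariskiTopology

/-! ### Retractions modulo the square of an ideal, and the Nullstellensatz -/

section FormalRetraction

/-- The order of a power series over a domain is additive: two factors of order below `n` have a
product of order below `n + n`. -/
theorem MvPolynomial.mem_pow_or_mem_pow_of_mul_mem {σ R : Type*} [CommRing R] [IsDomain R] (n : ℕ)
    {a b : MvPolynomial σ R} (h : a * b ∈ MvPolynomial.idealOfVars σ R ^ (n + n)) :
    a ∈ MvPolynomial.idealOfVars σ R ^ n ∨ b ∈ MvPolynomial.idealOfVars σ R ^ n := by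
  have key : ∀ (m : ℕ) (c : MvPolynomial σ R),
      c ∈ MvPolynomial.idealOfVars σ R ^ m ↔ (m : ℕ∞) ≤ (c : MvPowerSeries σ R).order := by
    intro m c
    rw [MvPolynomial.mem_pow_idealOfVars_iff']
    constructor
    · intro hc
      refine MvPowerSeries.nat_le_order fun d hd => ?_
      rw [MvPolynomial.coeff_coe]
      exact hc d hd
    · intro hc d hd
      rw [← MvPolynomial.coeff_coe]
      exact MvPowerSeries.coeff_of_lt_order (lt_of_lt_of_le (by exact_mod_cast hd) hc)
  rw [key, MvPolynomial.coe_mul, MvPowerSeries.order_mul] at h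
  rw [key, key]
  by_contra! hc
  have := ENat.add_lt_add hc.1 hc.2
  rw [← Nat.cast_add] at this
  exact absurd h (not_le.2 this)

/-- If `F` retracts the first order neighbourhood of `V(J)` onto `V(J)`, and the `m`-adic order on
`A` is additive, then at the point `m` the ring `A ⧸ J` is locally a domain. -/
theorem exists_notMem_and_mul_mem_of_retraction {A : Type*} [CommRing A] [IsNoetherianRing A]
    {m J : Ideal A} (hm : m ≠ ⊤) (hJm : J ≤ m)
    (hval : ∀ n, ∀ a b, a * b ∈ m ^ (n + n) → a ∈ m ^ n ∨ b ∈ m ^ n)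
    (F : A →+* A) (hF : ∀ a, F a - a ∈ J) (hFJ : J.map F ≤ J ^ 2) {a b : A} (hab : a * b ∈ J) :
    ∃ u, u ∉ m ∧ (u * a ∈ J ∨ u * b ∈ J) := by
  -- Quadratic convergence, as in Newton's method: each application of `F` doubles the exponent of
  -- `J`.
  have hiter : ∀ n, ∀ c ∈ J, F^[n] c ∈ J ^ (2 ^ n) := by
    intro n
    have : ∀ c ∈ J, (F ^ n) c ∈ J ^ (2 ^ n) := by
      induction n with
      | zero => intro c hc; simpa using hc
      | succ n ih =>
        intro c hc
        have h1 : F ((F ^ n) c) ∈ (J ^ (2 ^ n)).map F := Ideal.mem_map_of_mem _ (ih c hc)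
        rw [Ideal.map_pow] at h1
        have h2 := Ideal.pow_right_mono hFJ (2 ^ n) h1
        rw [← pow_mul, ← pow_succ'] at h2
        exact (DFunLike.congr_fun (pow_succ' F n) c) ▸ h2
    intro c hc
    rw [← RingHom.coe_pow]
    exact this c hc
  have hsub : ∀ n c, F^[n] c - c ∈ J := by
    intro n c
    induction n with
    | zero => simp
    | succ n ih =>
      rw [Function.iterate_succ_apply']
      have := J.add_mem (hF (F^[n] c)) ih
      simpa using this
  -- The iterate `F^[n+1]` moves `a * b` into `m ^ (2^n + 2^n)`, so one factor lands in `m ^ (2^n)`.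
  -- Since iterates of `F` change elements only by `J`, that factor was already in `J ⊔ m ^ l` for
  -- all `l ≤ n`.
  have hor : (∀ n, a ∈ J ⊔ m ^ n) ∨ (∀ n, b ∈ J ⊔ m ^ n) := by
    by_contra! hc
    obtain ⟨⟨n₁, h₁⟩, ⟨n₂, h₂⟩⟩ := hc
    set n := max n₁ n₂
    have hn : n ≤ 2 ^ n := Nat.lt_two_pow_self.le
    have h := hiter (n + 1) _ hab
    have hmul : F^[n + 1] (a * b) = F^[n + 1] a * F^[n + 1] b := by
      rw [← RingHom.coe_pow, map_mul]
    rw [hmul] at h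
    have h := Ideal.pow_right_mono hJm _ h
    rw [pow_succ, mul_two] at h
    have lift : ∀ c, F^[n + 1] c ∈ m ^ (2 ^ n) → ∀ l ≤ n, c ∈ J ⊔ m ^ l := by
      intro c hc l hl
      have e : c = -(F^[n + 1] c - c) + F^[n + 1] c := by ring
      rw [e]
      exact Submodule.add_mem_sup (J.neg_mem (hsub _ _)) (Ideal.pow_le_pow_right (hl.trans hn) hc)
    rcases hval _ _ _ h with h | h
    · exact h₁ (lift a h _ (le_max_left _ _))
    · exact h₂ (lift b h _ (le_max_right _ _))
  -- Krull's intersection theorem in `A ⧸ J`: an element of all powers of the image of `m` is killed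
  -- by some `1 - s` with `s ∈ m`.
  have krull : ∀ c, (∀ n, c ∈ J ⊔ m ^ n) → ∃ u, u ∉ m ∧ u * c ∈ J := by
    intro c hc
    let π := Ideal.Quotient.mk J
    have hπ : Function.Surjective π := Ideal.Quotient.mk_surjective
    have h1 : π c ∈ (⨅ i : ℕ, (m.map π) ^ i • ⊤ : Submodule (A ⧸ J) (A ⧸ J)) := by
      rw [Submodule.mem_iInf]
      intro n
      obtain ⟨x, hx, y, hy, rfl⟩ := Submodule.mem_sup.1 (hc n)
      rw [map_add, show π x = 0 from Ideal.Quotient.eq_zero_iff_mem.2 hx, zero_add, smul_eq_mul,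
        Ideal.mul_top, ← Ideal.map_pow]
      exact Ideal.mem_map_of_mem _ hy
    rw [Ideal.mem_iInf_smul_pow_eq_bot_iff] at h1
    obtain ⟨⟨r, hr⟩, hrc⟩ := h1
    obtain ⟨s, hs, rfl⟩ := (Ideal.mem_map_iff_of_surjective π hπ).1 hr
    refine ⟨1 - s, fun h => hm ?_, ?_⟩
    · rw [Ideal.eq_top_iff_one]
      simpa using m.add_mem h hs
    · rw [← Ideal.Quotient.eq_zero_iff_mem]
      change π _ = 0
      rw [map_mul, map_sub, map_one, sub_mul, one_mul, sub_eq_zero]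
      exact hrc.symm
  rcases hor with h | h
  · obtain ⟨u, hu, h⟩ := krull a h
    exact ⟨u, hu, Or.inl h⟩
  · obtain ⟨u, hu, h⟩ := krull b h
    exact ⟨u, hu, Or.inr h⟩

variable {k : Type*} [Field k] {V : Type*} [AddCommGroup V] [Module k V] [Module.Finite k V]

/-- Coordinates centred at `x` turn the ideal of `x` into the ideal of the variables, where
additivity of the order applies. -/
theorem polyFunctions_mem_pow_or_mem_pow [Infinite k] (x : V) (n : ℕ) (a b : polyFunctions k V)
    (h : a * b ∈ RingHom.ker (polyEval (k := k) x) ^ (n + n)) :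
    a ∈ RingHom.ker (polyEval (k := k) x) ^ n ∨ b ∈ RingHom.ker (polyEval (k := k) x) ^ n := by
  let e := AlgEquiv.ofBijective (coordHom (k := k) x) ⟨coordHom_injective x, coordHom_surjective x⟩
  let er : MvPolynomial (Fin (Module.finrank k V)) k →+* polyFunctions k V := e
  have her : Function.Surjective er := e.surjective
  have hker : ∀ q, e q ∈ RingHom.ker (polyEval (k := k) x) ↔
      q ∈ MvPolynomial.idealOfVars (Fin (Module.finrank k V)) k := by
    intro q
    have h1 : (coordHom x q : V → k) x = _ := coordHom_apply x x q
    have h2 : (fun i => (Module.finBasis k V).repr (x - x) i) = 0 := by ext i; simp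
    rw [h2] at h1
    rw [RingHom.mem_ker, polyEval_apply]
    change (coordHom x q : V → k) x = 0 ↔ _
    rw [h1, ← pow_one (MvPolynomial.idealOfVars _ _), MvPolynomial.mem_pow_idealOfVars_iff']
    have h3 : MvPolynomial.eval (0 : Fin (Module.finrank k V) → k) q = q.coeff 0 := by
      rw [MvPolynomial.eval_zero, MvPolynomial.constantCoeff_eq]
    rw [h3]
    constructor
    · intro h d hd
      rw [Nat.lt_one_iff, Finsupp.degree_eq_zero_iff] at hd
      rw [hd, h]
    · intro h
      exact h 0 (by simp)
  have hmap : RingHom.ker (polyEval (k := k) x) =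
      (MvPolynomial.idealOfVars (Fin (Module.finrank k V)) k).map er := by
    ext f
    rw [Ideal.mem_map_iff_of_surjective _ her]
    constructor
    · intro hf
      obtain ⟨q, rfl⟩ := e.surjective f
      exact ⟨q, (hker q).1 hf, rfl⟩
    · rintro ⟨q, hq, rfl⟩
      exact (hker q).2 hq
  have hpow : ∀ m q, e q ∈ RingHom.ker (polyEval (k := k) x) ^ m ↔
      q ∈ MvPolynomial.idealOfVars (Fin (Module.finrank k V)) k ^ m := by
    intro m q
    rw [hmap, ← Ideal.map_pow, Ideal.mem_map_iff_of_surjective _ her]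
    constructor
    · rintro ⟨q', hq', h⟩
      rwa [← e.injective h]
    · intro h
      exact ⟨q, h, rfl⟩
  obtain ⟨a, rfl⟩ := e.surjective a
  obtain ⟨b, rfl⟩ := e.surjective b
  rw [← map_mul, hpow] at h
  rw [hpow, hpow]
  exact MvPolynomial.mem_pow_or_mem_pow_of_mul_mem n h

instance : IsJacobsonRing (polyFunctions k V) :=
  isJacobsonRing_of_surjective ⟨(coordHom (k := k) (0 : V)).toRingHom, coordHom_surjective 0⟩

/-- Zariski's lemma: the residue field is finite over the algebraically closed field `K`, hence
equal to it. -/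
theorem exists_algHom_ker_eq_of_isMaximal {K A : Type*} [Field K] [IsAlgClosed K] [CommRing A]
    [Algebra K A] [Algebra.FiniteType K A] (M : Ideal A) [M.IsMaximal] :
    ∃ e : A →ₐ[K] K, RingHom.ker e = M := by
  have : Algebra.FiniteType K (A ⧸ M) :=
    Algebra.FiniteType.of_surjective (Ideal.Quotient.mkₐ K M) Ideal.Quotient.mk_surjective
  let := Ideal.Quotient.field M
  have : Module.Finite K (A ⧸ M) := finite_of_finite_type_of_isJacobsonRing _ _
  let e : (A ⧸ M) ≃ₐ[K] K := (AlgEquiv.ofBijective (Algebra.ofId K _)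
    IsAlgClosed.algebraMap_bijective_of_isIntegral).symm
  refine ⟨(e : (A ⧸ M) →ₐ[K] K).comp (Ideal.Quotient.mkₐ K M), ?_⟩
  ext f
  rw [RingHom.mem_ker, ← Ideal.Quotient.eq_zero_iff_mem]
  exact map_eq_zero_iff e e.injective

theorem exists_eq_ker_polyEval [IsAlgClosed k] (M : Ideal (polyFunctions k V)) [M.IsMaximal] :
    ∃ v, M = RingHom.ker (polyEval (k := k) v) := by
  obtain ⟨e, rfl⟩ := exists_algHom_ker_eq_of_isMaximal (K := k) M
  obtain ⟨v, rfl⟩ := eq_polyEval e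
  exact ⟨v, rfl⟩

/-- **Nullstellensatz** for polynomial functions on a vector space. -/
theorem polyFunctions_nullstellensatz [IsAlgClosed k] (J : Ideal (polyFunctions k V))
    (f : polyFunctions k V)
    (hf : ∀ v, (∀ g ∈ J, (g : V → k) v = 0) → (f : V → k) v = 0) : f ∈ J.radical := by
  rw [← IsJacobsonRing.out inferInstance (Ideal.radical_isRadical J), Ideal.jacobson,
    Ideal.mem_sInf]
  rintro M ⟨hM, hMmax⟩
  obtain ⟨v, rfl⟩ := exists_eq_ker_polyEval M
  exact hf v fun g hg => hM (Ideal.le_radical hg)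

end FormalRetraction

/-! ### The `p`-map -/

section PMap

variable {p : ℕ} {k : Type*} [Field k]
variable {L : Type*} [LieRing L] [LieAlgebra k L]

/-- The rightmost factor of the power already annihilates `z`, which is why the exponent must be
positive. -/
theorem coeff_ad_pow_apply_eq_zero {x y z : L} (hx : ⁅x, z⁆ = 0) (hy : ⁅y, z⁆ = 0) (n i : ℕ) :
    ((Polynomial.C (LieAlgebra.ad k L x) * Polynomial.X
      + Polynomial.C (LieAlgebra.ad k L y)) ^ (n + 1)).coeff i z = 0 := by
  rw [pow_succ, mul_add, ← mul_assoc, Polynomial.coeff_add, Polynomial.coeff_mul_C]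
  cases i with
  | zero => simp [hy]
  | succ i => rw [Polynomial.coeff_mul_X, Polynomial.coeff_mul_C]; simp [hx, hy]

variable [RestrictedLieAlgebra p k L]

theorem pPow_smul (a : k) (x : L) : pPow p k (a • x) = a ^ p • pPow p k x :=
  RestrictedLieAlgebra.smul_pPow a x

theorem iterate_pPow_smul (a : k) (x : L) (i : ℕ) :
    (pPow p k)^[i] (a • x) = a ^ p ^ i • (pPow p k)^[i] x := by
  induction i with
  | zero => simp
  | succ i ih =>
    simp only [Function.iterate_succ_apply']
    rw [ih, pPow_smul, ← pow_mul, ← pow_succ]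

variable [hp : Fact p.Prime]

theorem pPow_zero : pPow p k (0 : L) = 0 := by
  have h := pPow_smul (p := p) (0 : k) (0 : L)
  rwa [zero_pow hp.out.ne_zero, zero_smul, zero_smul] at h

theorem pPow_add_of_lie_eq_zero {x y : L} (h : ⁅x, y⁆ = 0) :
    pPow p k (x + y) = pPow p k x + pPow p k y := by
  refine (RestrictedLieAlgebra.add_pPow (p := p) (k := k) x y).trans ?_
  have h' : ⁅y, x⁆ = 0 := by rw [← lie_skew, h, neg_zero]
  have e : p - 1 = (p - 2) + 1 := by have := hp.out.two_le; omega
  have : jacobsonSum p k x y = 0 := by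
    refine Finset.sum_eq_zero fun i _ => ?_
    rw [e, coeff_ad_pow_apply_eq_zero (lie_self x) h', smul_zero]
  rw [this, add_zero]
  rfl

theorem lie_pPow_left {x y : L} (h : ⁅x, y⁆ = 0) : ⁅pPow p k x, y⁆ = 0 := by
  have h1 := LinearMap.congr_fun (RestrictedLieAlgebra.ad_pPow (p := p) (k := k) x) y
  have e : LieAlgebra.ad k L x ^ p = LieAlgebra.ad k L x ^ (p - 1) * LieAlgebra.ad k L x := by
    rw [← pow_succ, Nat.sub_add_cancel hp.out.one_le]
  rw [e] at h1
  simp only [LieAlgebra.ad_apply, Module.End.mul_apply, h, map_zero] at h1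
  exact h1

theorem lie_iterate_pPow_left {x y : L} (h : ⁅x, y⁆ = 0) (i : ℕ) : ⁅(pPow p k)^[i] x, y⁆ = 0 := by
  induction i with
  | zero => exact h
  | succ i ih => rw [Function.iterate_succ_apply']; exact lie_pPow_left ih

theorem lie_iterate_pPow_right {x y : L} (h : ⁅x, y⁆ = 0) (i : ℕ) :
    ⁅x, (pPow p k)^[i] y⁆ = 0 := by
  rw [← lie_skew, neg_eq_zero]
  refine lie_iterate_pPow_left ?_ i
  rw [← lie_skew, h, neg_zero]

theorem lie_iterate_pPow {x y : L} (h : ⁅x, y⁆ = 0) (i j : ℕ) :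
    ⁅(pPow p k)^[i] x, (pPow p k)^[j] y⁆ = 0 :=
  lie_iterate_pPow_left (lie_iterate_pPow_right h j) i

theorem iterate_pPow_add {x y : L} (h : ⁅x, y⁆ = 0) (i : ℕ) :
    (pPow p k)^[i] (x + y) = (pPow p k)^[i] x + (pPow p k)^[i] y := by
  induction i with
  | zero => rfl
  | succ i ih =>
    simp only [Function.iterate_succ_apply']
    rw [ih, pPow_add_of_lie_eq_zero (lie_iterate_pPow h i i)]

theorem pPow_sum_of_lie_eq_zero {ι : Type*} (s : Finset ι) (x : ι → L)
    (h : ∀ i j, ⁅x i, x j⁆ = 0) : pPow p k (∑ i ∈ s, x i) = ∑ i ∈ s, pPow p k (x i) := by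
  classical
  induction s using Finset.induction_on with
  | empty => exact pPow_zero
  | insert i s hi ih =>
    rw [Finset.sum_insert hi, Finset.sum_insert hi, pPow_add_of_lie_eq_zero, ih]
    rw [lie_sum]
    exact Finset.sum_eq_zero fun j _ => h i j

variable (p) in
/-- The `p`-polynomial `∑_{i<n} cᵢ x^[p]^i`. -/
def pPoly (n : ℕ) (c : ℕ → k) (x : L) : L := ∑ i ∈ Finset.range n, c i • (pPow p k)^[i] x

theorem pPoly_add (n : ℕ) (c : ℕ → k) {x y : L} (h : ⁅x, y⁆ = 0) :
    pPoly p n c (x + y) = pPoly p n c x + pPoly p n c y := by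
  simp only [pPoly, iterate_pPow_add h, smul_add, Finset.sum_add_distrib]

theorem lie_pPoly_self (n : ℕ) (c : ℕ → k) (x : L) : ⁅x, pPoly p n c x⁆ = 0 := by
  rw [pPoly, lie_sum]
  exact Finset.sum_eq_zero fun i _ => by
    rw [lie_smul, lie_iterate_pPow_right (lie_self x), smul_zero]

end PMap

/-! ### Maps with coordinates in an ideal -/

section CoordsIn

variable {p : ℕ} {k : Type*} [Field k] {V : Type*} [AddCommGroup V] [Module k V]
variable {L : Type*} [LieRing L] [LieAlgebra k L]

/-- The coordinates of the map `F` belong to the ideal `I` of polynomial functions. -/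
def CoordsIn (I : Ideal (polyFunctions k V)) (F : V → L) : Prop :=
  ∀ l : Module.Dual k L, ∃ a ∈ I, (a : V → k) = l ∘ F

namespace CoordsIn

variable {I J : Ideal (polyFunctions k V)} {F E : V → L}

theorem isPolyMap (h : CoordsIn I F) : IsPolyMap k F := fun l => by
  obtain ⟨a, -, ha⟩ := h l
  rw [← ha]
  exact a.2

theorem of_isPolyMap (h : IsPolyMap k F) : CoordsIn (⊤ : Ideal (polyFunctions k V)) F :=
  fun l => ⟨⟨_, h l⟩, trivial, rfl⟩

theorem mono (hIJ : I ≤ J) (h : CoordsIn I F) : CoordsIn J F := fun l => by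
  obtain ⟨a, ha, h⟩ := h l
  exact ⟨a, hIJ ha, h⟩

theorem zero : CoordsIn I (fun _ => (0 : L)) := fun l => ⟨0, I.zero_mem, by ext; simp⟩

theorem add (hF : CoordsIn I F) (hE : CoordsIn I E) : CoordsIn I (fun v => F v + E v) := fun l => by
  obtain ⟨a, ha, h⟩ := hF l
  obtain ⟨b, hb, h'⟩ := hE l
  refine ⟨a + b, I.add_mem ha hb, ?_⟩
  ext v
  simp [h, h']

theorem smul {a : polyFunctions k V} (ha : a ∈ I) (hF : CoordsIn J F) :
    CoordsIn (I * J) (fun v => (a : V → k) v • F v) := fun l => by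
  obtain ⟨b, hb, h⟩ := hF l
  refine ⟨a * b, Ideal.mul_mem_mul ha hb, ?_⟩
  ext v
  simp [h]

theorem comp_linear (hF : CoordsIn I F) (T : L →ₗ[k] L) : CoordsIn I (fun v => T (F v)) :=
  fun l => hF (l.comp T)

theorem const_smul (c : k) (hF : CoordsIn I F) : CoordsIn I (fun v => c • F v) :=
  hF.comp_linear (c • LinearMap.id)

theorem sum {ι : Type*} (s : Finset ι) {F : ι → V → L} (hF : ∀ i ∈ s, CoordsIn I (F i)) :
    CoordsIn I (fun v => ∑ i ∈ s, F i v) := by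
  classical
  induction s using Finset.induction_on with
  | empty => simpa using zero
  | insert i s hi ih =>
    simp only [Finset.sum_insert hi]
    exact (hF i (Finset.mem_insert_self i s)).add
      (ih fun j hj => hF j (Finset.mem_insert_of_mem hj))

theorem smul_const {a : polyFunctions k V} (ha : a ∈ I) (x : L) :
    CoordsIn I (fun v => (a : V → k) v • x) := by
  have := smul (F := fun _ : V => x) ha (of_isPolyMap (isPolyMap_const x))
  rwa [Ideal.mul_top] at this

variable [Module.Finite k L]

theorem lie (hF : CoordsIn I F) (hE : CoordsIn J E) : CoordsIn (I * J) (fun v => ⁅F v, E v⁆) := by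
  let b := Module.finBasis k L
  choose a ha h using fun i => hF (b.coord i)
  have e : (fun v => ⁅F v, E v⁆) = fun v => ∑ i, (a i : V → k) v • LieAlgebra.ad k L (b i) (E v) := by
    ext v
    conv_lhs => rw [← b.sum_repr (F v)]
    rw [sum_lie]
    refine Finset.sum_congr rfl fun i _ => ?_
    rw [smul_lie, h]
    rfl
  rw [e]
  exact sum _ fun i _ => smul (ha i) (hE.comp_linear _)

/-- Each of the `n` brackets with `F` or `E` contributes one factor of `I`. -/
theorem coeff_ad_pow {G : V → L} (hF : CoordsIn I F) (hE : CoordsIn I E) (hG : CoordsIn J G)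
    (n i : ℕ) : CoordsIn (I ^ n * J) (fun v =>
      ((Polynomial.C (LieAlgebra.ad k L (F v)) * Polynomial.X
        + Polynomial.C (LieAlgebra.ad k L (E v))) ^ n).coeff i (G v)) := by
  induction n generalizing i with
  | zero =>
    simp only [pow_zero, Polynomial.coeff_one, Ideal.one_eq_top, Ideal.top_mul]
    split_ifs
    · exact hG
    · exact zero
  | succ n ih =>
    rw [pow_succ', mul_assoc]
    cases i with
    | zero => simpa [pow_succ', add_mul, mul_assoc] using hE.lie (ih 0)
    | succ i =>
      simpa [pow_succ', add_mul, mul_assoc, Polynomial.coeff_C_mul] using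
        (hF.lie (ih i)).add (hE.lie (ih (i + 1)))

variable [RestrictedLieAlgebra p k L] [hp : Fact p.Prime]

/-- The `p`-map has no terms of order below two. Adding basis terms one at a time produces `aᵢ ^ p`,
with `p ≥ 2`, and Jacobson sums, whose terms have `p - 1` brackets applied to an argument with
coordinates in `I` and so lie in `I ^ (p - 1) * I`. -/
theorem pPow (hF : CoordsIn I F) : CoordsIn (I ^ 2) (fun v => pPow p k (F v)) := by
  classical
  let b := Module.finBasis k L
  choose a ha h using fun i => hF (b.coord i)
  have key : ∀ s : Finset (Fin (Module.finrank k L)),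
      CoordsIn I (fun v => ∑ i ∈ s, (a i : V → k) v • b i) ∧
      CoordsIn (I ^ 2) (fun v => _root_.pPow p k (∑ i ∈ s, (a i : V → k) v • b i)) := by
    intro s
    refine ⟨sum _ fun i _ => smul_const (ha i) _, ?_⟩
    induction s using Finset.induction_on with
    | empty => simpa [pPow_zero] using zero
    | insert i s hi ih =>
      have e : (fun v => _root_.pPow p k (∑ j ∈ insert i s, (a j : V → k) v • b j)) = fun v =>
          ((a i : V → k) v ^ p • _root_.pPow p k (b i)
            + _root_.pPow p k (∑ j ∈ s, (a j : V → k) v • b j))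
            + jacobsonSum p k ((a i : V → k) v • b i) (∑ j ∈ s, (a j : V → k) v • b j) := by
        ext v
        rw [Finset.sum_insert hi, ← pPow_smul]
        exact RestrictedLieAlgebra.add_pPow _ _
      rw [e]
      have h1 : CoordsIn (I ^ 2) fun v => (a i : V → k) v ^ p • _root_.pPow p k (b i) :=
        smul_const (a := a i ^ p) (Ideal.pow_le_pow_right hp.out.two_le (Ideal.pow_mem_pow (ha i) p)) _
      refine (h1.add ih).add ?_
      have h2 := smul_const (ha i) (b i)
      have h3 : CoordsIn I (fun v => ∑ j ∈ s, (a j : V → k) v • b j) :=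
        sum _ fun i _ => smul_const (ha i) _
      have hpow : I ^ (p - 1) * I ≤ I ^ 2 := by
        rw [← pow_succ]
        exact Ideal.pow_le_pow_right (by have := hp.out.two_le; omega)
      exact sum _ fun j _ => const_smul _ ((coeff_ad_pow h2 h3 h2 (p - 1) j).mono hpow)
  have e : (fun v => _root_.pPow p k (F v)) =
      fun v => _root_.pPow p k (∑ i, (a i : V → k) v • b i) := by
    ext v
    conv_lhs => rw [← b.sum_repr (F v)]
    simp only [h]
    rfl
  rw [e]
  exact (key _).2

theorem iterate_pPow (hF : CoordsIn I F) (i : ℕ) :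
    CoordsIn (I ^ 2) (fun v => (_root_.pPow p k)^[i + 1] (F v)) := by
  induction i with
  | zero => exact hF.pPow
  | succ i ih =>
    simp only [Function.iterate_succ_apply' _ (i + 1)]
    exact (ih.pPow (p := p)).mono (Ideal.pow_le_self two_ne_zero)

end CoordsIn

variable [Module.Finite k L] [RestrictedLieAlgebra p k L] [hp : Fact p.Prime]

theorem isPolyMap_pPow : IsPolyMap k (pPow p k : L → L) :=
  (CoordsIn.of_isPolyMap (LinearMap.id : L →ₗ[k] L).isPolyMap).pPow.isPolyMap

theorem isPolyMap_iterate_pPow (i : ℕ) : IsPolyMap k ((pPow p k)^[i] : L → L) := by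
  induction i with
  | zero => exact (LinearMap.id : L →ₗ[k] L).isPolyMap
  | succ i ih => rw [Function.iterate_succ']; exact isPolyMap_pPow.comp ih

theorem isPolyMap_pPoly (n : ℕ) (c : ℕ → k) : IsPolyMap k (pPoly p n c : L → L) :=
  IsPolyMap.sum _ fun i _ => IsPolyMap.const_smul _ (isPolyMap_iterate_pPow i)

/-- The zero set of a `p`-polynomial with nonvanishing linear term is locally irreducible. -/
theorem pPoly_zeros_locally_irreducible [IsAlgClosed k] (r : ℕ) (c : ℕ → k) (hc : c 0 ≠ 0)
    {x₀ : L} (hx₀ : pPoly p (r + 1) c x₀ = 0) {f g : L → k} (hf : f ∈ polyFunctions k L)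
    (hg : g ∈ polyFunctions k L) (hfg : ∀ x, pPoly p (r + 1) c x = 0 → f x * g x = 0) :
    ∃ u ∈ polyFunctions k L, u x₀ ≠ 0 ∧
      ((∀ x, pPoly p (r + 1) c x = 0 → u x ≠ 0 → f x = 0) ∨
        ∀ x, pPoly p (r + 1) c x = 0 → u x ≠ 0 → g x = 0) := by
  have : Infinite k := IsAlgClosed.instInfinite
  set P : L → L := pPoly p (r + 1) c with hP
  have hPpoly : IsPolyMap k P := isPolyMap_pPoly _ _
  let J : Ideal (polyFunctions k L) :=
    Ideal.span (Set.range fun l : Module.Dual k L => ⟨l ∘ P, hPpoly l⟩)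
  have hPJ : CoordsIn J P := fun l => ⟨_, Ideal.subset_span ⟨l, rfl⟩, rfl⟩
  have hJ : ∀ a ∈ J, ∀ x, P x = 0 → (a : L → k) x = 0 := by
    intro a ha x hx
    have : J ≤ RingHom.ker (polyEval (k := k) x) := by
      rw [Ideal.span_le]
      rintro _ ⟨l, rfl⟩
      change l (P x) = 0
      rw [hx, map_zero]
    exact this ha
  -- The Newton correction for `P`, whose linear part is the scalar `c 0`.
  let v : L → L := fun x => -(c 0)⁻¹ • P x
  have hv : CoordsIn J v := hPJ.const_smul _
  let F : L → L := fun x => x + v x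
  have hF : IsPolyMap k F := (LinearMap.id : L →ₗ[k] L).isPolyMap.add hv.isPolyMap
  have hPF : CoordsIn (J ^ 2) (P ∘ F) := by
    -- Because `x` commutes with `v x`, `P (x + v x) = P x + P (v x)`. The linear term of `P (v x)`
    -- cancels `P x`, leaving only genuine `p`-powers of `v x`, which are of order two in `J`.
    have e : P ∘ F = fun x => ∑ i ∈ Finset.range r, c (i + 1) • (pPow p k)^[i + 1] (v x) := by
      ext x
      change pPoly p (r + 1) c (x + v x) = _
      have h0 : ⁅x, v x⁆ = 0 := by rw [lie_smul, lie_pPoly_self, smul_zero]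
      rw [pPoly_add _ _ h0, pPoly, pPoly, Finset.sum_range_succ' (fun i =>
        c i • (pPow p k)^[i] (v x)) r, add_comm, add_assoc]
      convert add_zero _
      rw [Function.iterate_zero, id, smul_smul, mul_neg, mul_inv_cancel₀ hc, neg_smul, one_smul]
      exact neg_add_cancel _
    rw [e]
    exact CoordsIn.sum _ fun i _ => (hv.iterate_pPow i).const_smul _
  have hnil : (⟨f * g, mul_mem hf hg⟩ : polyFunctions k L) ∈ J.radical := by
    refine polyFunctions_nullstellensatz _ _ fun x hx => hfg x ?_
    rw [← Module.forall_dual_apply_eq_zero_iff k]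
    intro l
    exact hx _ (Ideal.subset_span ⟨l, rfl⟩)
  obtain ⟨N, hN⟩ := hnil
  have hcomap : ∀ a, hF.comap a - a ∈ J := by
    rintro ⟨a, ha⟩
    induction ha using Algebra.adjoin_induction with
    | mem a ha =>
      obtain ⟨l, rfl⟩ := ha
      obtain ⟨b, hb, h⟩ := hv l
      convert hb
      ext x
      simp [h, F]
    | algebraMap s =>
      convert J.zero_mem
      exact sub_eq_zero.2 (hF.comap.commutes s)
    | add a b ha hb h₁ h₂ =>
      have := J.add_mem h₁ h₂
      convert this using 1
      ext x
      simp
      ring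
    | mul a b ha hb h₁ h₂ =>
      have := J.add_mem (J.mul_mem_left (hF.comap ⟨a, ha⟩) h₂) (J.mul_mem_right ⟨b, hb⟩ h₁)
      convert this using 1
      ext x
      simp
      ring
  have hmap : J.map (hF.comap : polyFunctions k L →+* polyFunctions k L) ≤ J ^ 2 := by
    rw [Ideal.map_span, Ideal.span_le]
    rintro _ ⟨_, ⟨l, rfl⟩, rfl⟩
    obtain ⟨b, hb, h⟩ := hPF l
    rw [SetLike.mem_coe]
    convert hb using 1
    ext x
    rw [h]
    rfl
  have hmtop : RingHom.ker (polyEval (k := k) x₀) ≠ ⊤ := RingHom.ker_ne_top _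
  -- `J` is not known to be radical: the Nullstellensatz only puts `(f * g) ^ N` in `J`, so the
  -- dichotomy is applied to `N`-th powers.
  obtain ⟨u, hu, h⟩ := exists_notMem_and_mul_mem_of_retraction (a := ⟨f, hf⟩ ^ N) (b := ⟨g, hg⟩ ^ N)
    hmtop (fun a ha => hJ a ha x₀ hx₀) (polyFunctions_mem_pow_or_mem_pow x₀) _ hcomap hmap
    (by rw [← mul_pow]; exact hN)
  refine ⟨u, u.2, hu, h.imp ?_ ?_⟩
  · intro h x hx hux
    exact eq_zero_of_pow_eq_zero ((mul_eq_zero.1 (hJ _ h x hx)).resolve_left hux)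
  · intro h x hx hux
    exact eq_zero_of_pow_eq_zero ((mul_eq_zero.1 (hJ _ h x hx)).resolve_left hux)

end CoordsIn

/-! ### Tori are generated by one element -/

section CyclicVector

variable {p : ℕ} {k : Type*} [Field k] [hp : Fact p.Prime]
variable {M : Type*} [LieRing M] [LieAlgebra k M] [RestrictedLieAlgebra p k M]

/-- The relation expressing the first dependent iterate of a semisimple element has nonzero
linear term. -/
theorem coeff_zero_ne_zero_of_iterate_pPow_eq {x : M} (hx : IsSemisimpleElement p k x) {m : ℕ}
    (hli : LinearIndependent k fun j : Fin (m + 1) => (pPow p k)^[(j : ℕ)] x) {c : Fin (m + 1) → k}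
    (hc : (pPow p k)^[m + 1] x = ∑ j : Fin (m + 1), c j • (pPow p k)^[(j : ℕ)] x) : c 0 ≠ 0 := by
  intro h0
  let e : Fin m → M := fun j => (pPow p k)^[(j : ℕ) + 1] x
  let U := Submodule.span k (Set.range e)
  have hm : (pPow p k)^[m + 1] x ∈ U := by
    rw [hc, Fin.sum_univ_succ, h0, zero_smul, zero_add]
    exact Submodule.sum_mem _ fun j _ => Submodule.smul_mem _ _ (Submodule.subset_span ⟨j, rfl⟩)
  have hstep : ∀ j ≤ m, (pPow p k)^[j + 1] x ∈ U := by
    intro j hj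
    rcases hj.lt_or_eq with h | rfl
    · exact Submodule.subset_span ⟨⟨j, h⟩, rfl⟩
    · exact hm
  -- With vanishing linear coefficient, the span `U` of the iterates from `1` to `m` is stable under
  -- the `p`-map. Semisimplicity then puts `x` itself in `U`, against independence.
  have hU : ∀ i, (pPow p k)^[i + 1] x ∈ U := by
    intro i
    induction i with
    | zero => exact hstep 0 (Nat.zero_le _)
    | succ i ih =>
      obtain ⟨d, hd⟩ := (Submodule.mem_span_range_iff_exists_fun k).1 ih
      rw [Function.iterate_succ_apply', ← hd]
      have : pPow p k (∑ j : Fin m, d j • e j) = ∑ j : Fin m, d j ^ p • pPow p k (e j) := by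
        rw [pPow_sum_of_lie_eq_zero]
        · simp only [pPow_smul]
        · intro i j
          rw [smul_lie, lie_smul, lie_iterate_pPow (lie_self x), smul_zero, smul_zero]
      rw [this]
      refine Submodule.sum_mem _ fun j _ => Submodule.smul_mem _ _ ?_
      have := hstep (j + 1) j.2
      rwa [Function.iterate_succ_apply'] at this
  have hxU : x ∈ U := Submodule.span_le.2 (by rintro _ ⟨i, rfl⟩; exact hU i) hx
  have hne : (0 : Fin (m + 1)) ∉ Set.range (Fin.succ : Fin m → Fin (m + 1)) := by
    rintro ⟨j, hj⟩
    exact Fin.succ_ne_zero j hj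
  refine hli.notMem_span_image hne ?_
  rw [← Set.range_comp]
  exact hxU

/-- A finite-dimensional torus over an infinite field is generated by one element as a restricted
Lie algebra. -/
theorem exists_cyclic_vector [Infinite k] [Module.Finite k M] (hab : ∀ x y : M, ⁅x, y⁆ = 0)
    (hss : ∀ x : M, IsSemisimpleElement p k x) :
    ∃ (r : ℕ) (h : M) (b : Module.Basis (Fin r) k M) (c : ℕ → k),
      (∀ i, b i = (pPow p k)^[(i : ℕ)] h) ∧ c 0 ≠ 0 ∧ c r = -1 ∧ pPoly p (r + 1) c h = 0 := by
  classical
  let S : Set ℕ := {m | ∃ x : M, LinearIndependent k fun j : Fin m => (pPow p k)^[(j : ℕ)] x}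
  have hSbdd : BddAbove S := ⟨Module.finrank k M, fun m ⟨x, hx⟩ => by
    simpa using hx.fintype_card_le_finrank⟩
  have hSne : S.Nonempty := ⟨0, 0, linearIndependent_empty_type⟩
  obtain ⟨x, hli⟩ : sSup S ∈ S := Nat.sSup_mem hSne hSbdd
  set m := sSup S with hm
  -- `m` is the largest number of independent initial iterates over all elements, so this holds for
  -- every `z`, in particular for perturbations of `x`.
  have hdep : ∀ z : M, ¬ LinearIndependent k fun j : Fin (m + 1) => (pPow p k)^[(j : ℕ)] z :=
    fun z hz => absurd (le_csSup hSbdd (show m + 1 ∈ S from ⟨z, hz⟩)) (by omega)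
  let W := Submodule.span k (Set.range fun j : Fin m => (pPow p k)^[(j : ℕ)] x)
  have hxm : (pPow p k)^[m] x ∈ W := by
    by_contra hcon
    refine hdep x ?_
    have := hli.finSnoc hcon
    convert this using 1
    ext j
    refine Fin.lastCases ?_ (fun j => ?_) j <;> simp
  obtain ⟨d, hd⟩ := (Submodule.mem_span_range_iff_exists_fun k).1 hxm
  have hd0 : ∀ hm : 0 < m, d ⟨0, hm⟩ ≠ 0 := by
    clear_value m
    cases m with
    | zero => exact fun h => absurd h (lt_irrefl 0)
    | succ m => exact fun _ => coeff_zero_ne_zero_of_iterate_pPow_eq (hss x) hli hd.symm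
  -- Up to scalars there is one relation among the first `m + 1` iterates of `x`. For `m > 0` its
  -- coefficient at `x` is nonzero, so a relation with `e 0 = 0` is trivial; for `m = 0`, `e 0` is
  -- the only coefficient.
  have hcoeff : ∀ e : Fin (m + 1) → k, e 0 = 0 →
      ∑ j, e j • (pPow p k)^[(j : ℕ)] x = 0 → e = 0 := by
    intro e he0 he
    rw [Fin.sum_univ_castSucc] at he
    simp only [Fin.val_castSucc, Fin.val_last] at he
    rw [← hd, Finset.smul_sum, ← Finset.sum_add_distrib] at he
    simp only [smul_smul, ← add_smul] at he
    have h1 := Fintype.linearIndependent_iff.1 hli _ he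
    have hlast : e (Fin.last m) = 0 := by
      rcases Nat.eq_zero_or_pos m with h | h
      · have : Fin.last m = 0 := by ext; simp [h]
        rw [this, he0]
      · have h2 := h1 ⟨0, h⟩
        have h3 : Fin.castSucc (⟨0, h⟩ : Fin m) = 0 := rfl
        rw [h3, he0, zero_add] at h2
        exact (mul_eq_zero.1 h2).resolve_right (hd0 h)
    ext j
    refine Fin.lastCases hlast (fun j => ?_) j
    have := h1 j
    rwa [hlast, zero_mul, add_zero] at this
  have hWtop : W = ⊤ := by
    by_contra hW
    obtain ⟨y, -, hy⟩ := SetLike.exists_of_lt (lt_top_iff_ne_top.2 hW)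
    obtain ⟨l, hly, hlW⟩ := Submodule.exists_le_ker_of_notMem hy
    let Φ : (Fin m → k) →ₗ[k] M := Fintype.linearCombination k fun j : Fin m => (pPow p k)^[(j : ℕ)] x
    obtain ⟨lam, hlam⟩ := LinearMap.exists_leftInverse_of_injective Φ
      (LinearMap.ker_eq_bot.2 hli.fintypeLinearCombination_injective)
    -- For `y ∉ W`, the columns record the iterates of `x + X y`: the first `m` rows are coordinates
    -- along `W`, and the last is the value of `l`, which kills `W`, divided by `X`. The division
    -- keeps `l y ≠ 0` visible at `X = 0`. Dependence of the iterates makes the determinant vanish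
    -- at every nonzero scalar, hence at `0` too, where a kernel vector contradicts `hcoeff`.
    let N : Matrix (Fin (m + 1)) (Fin (m + 1)) (Polynomial k) := Matrix.of fun i j =>
      Fin.lastCases (motive := fun _ => Polynomial k)
        (Polynomial.X ^ (p ^ (j : ℕ) - 1) * Polynomial.C (l ((pPow p k)^[(j : ℕ)] y)))
        (fun i => Polynomial.C (lam ((pPow p k)^[(j : ℕ)] x) i)
          + Polynomial.X ^ (p ^ (j : ℕ)) * Polynomial.C (lam ((pPow p k)^[(j : ℕ)] y) i)) i
    have hNlast : ∀ a j, (N (Fin.last m) j).eval a =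
        a ^ (p ^ (j : ℕ) - 1) * l ((pPow p k)^[(j : ℕ)] y) := by
      intro a j; simp [N]; ring
    have hNcast : ∀ a i j, (N (Fin.castSucc i) j).eval a =
        lam ((pPow p k)^[(j : ℕ)] x) i + a ^ (p ^ (j : ℕ)) * lam ((pPow p k)^[(j : ℕ)] y) i := by
      intro a i j; simp [N]; ring
    have hdet : ∀ a, N.det.eval a = ((Polynomial.evalRingHom a).mapMatrix N).det := by
      intro a
      rw [← RingHom.map_det]
      rfl
    have hlx : ∀ j ≤ m, l ((pPow p k)^[j] x) = 0 := by
      intro j hj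
      refine hlW ?_
      rcases hj.lt_or_eq with h | rfl
      · exact Submodule.subset_span ⟨⟨j, h⟩, rfl⟩
      · exact hxm
    have hzero : ∀ a ≠ 0, N.det.eval a = 0 := by
      intro a ha
      rw [hdet]
      have := hdep (x + a • y)
      rw [Fintype.linearIndependent_iff] at this
      push Not at this
      obtain ⟨g, hg, i, hi⟩ := this
      rw [← Matrix.exists_mulVec_eq_zero_iff]
      refine ⟨g, fun h => hi (congrFun h i), ?_⟩
      have hxy : ∀ j, (pPow p k)^[j] (x + a • y) =
          (pPow p k)^[j] x + a ^ p ^ j • (pPow p k)^[j] y := by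
        intro j
        rw [iterate_pPow_add (hab _ _), iterate_pPow_smul]
      simp only [hxy] at hg
      ext i
      rw [Matrix.mulVec, dotProduct]
      refine Fin.lastCases ?_ (fun i => ?_) i
      · have h1 := congrArg l hg
        simp only [map_sum, map_smul, map_add, map_zero, smul_eq_mul] at h1
        refine mul_left_cancel₀ ha ?_
        rw [Finset.mul_sum, Pi.zero_apply, mul_zero, ← h1]
        refine Finset.sum_congr rfl fun j _ => ?_
        rw [hlx j (Nat.lt_succ_iff.1 j.2), zero_add]
        change a * ((N (Fin.last m) j).eval a * g j) = _
        have hpj : a ^ p ^ (j : ℕ) = a * a ^ (p ^ (j : ℕ) - 1) := by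
          rw [← pow_succ', Nat.sub_add_cancel (Nat.one_le_pow _ _ hp.out.pos)]
        rw [hNlast, hpj]
        ring
      · have h1 := congrFun (congrArg lam hg) i
        simp only [map_sum, map_smul, map_add, map_zero, smul_eq_mul, Finset.sum_apply,
          Pi.smul_apply, Pi.add_apply] at h1
        refine Eq.trans ?_ h1
        refine Finset.sum_congr rfl fun j _ => ?_
        change (N (Fin.castSucc i) j).eval a * g j = _
        rw [hNcast]
        ring
    have hN0 : N.det = 0 := by
      refine Polynomial.eq_zero_of_infinite_isRoot _ (Set.Infinite.mono (s := {0}ᶜ) ?_ ?_)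
      · exact fun a ha => hzero a ha
      · exact (Set.finite_singleton 0).infinite_compl
    have h0 : ((Polynomial.evalRingHom 0).mapMatrix N).det = 0 := by
      rw [← hdet, hN0, Polynomial.eval_zero]
    obtain ⟨e, he, hNe⟩ := Matrix.exists_mulVec_eq_zero_iff.2 h0
    refine he (hcoeff e ?_ ?_)
    · have h1 : ∑ j, (N (Fin.last m) j).eval 0 * e j = 0 := congrFun hNe (Fin.last m)
      simp only [hNlast] at h1
      rw [Finset.sum_eq_single 0] at h1
      · simpa [hly] using h1
      · intro j _ hj
        have : 1 < p ^ (j : ℕ) := Nat.one_lt_pow (fun h => hj (Fin.ext h)) hp.out.one_lt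
        rw [zero_pow (by omega), zero_mul, zero_mul]
      · simp
    · have h1 : lam (∑ j, e j • (pPow p k)^[(j : ℕ)] x) = 0 := by
        ext i
        have h2 : ∑ j, (N (Fin.castSucc i) j).eval 0 * e j = 0 := congrFun hNe (Fin.castSucc i)
        simp only [hNcast] at h2
        rw [map_sum, Finset.sum_apply, Pi.zero_apply, ← h2]
        refine Finset.sum_congr rfl fun j _ => ?_
        rw [zero_pow (pow_ne_zero _ hp.out.ne_zero), zero_mul, add_zero, map_smul, Pi.smul_apply,
          smul_eq_mul, mul_comm]
      have h2 : ∑ j, e j • (pPow p k)^[(j : ℕ)] x ∈ W := by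
        refine Submodule.sum_mem _ fun j _ => Submodule.smul_mem _ _ ?_
        rcases (Nat.lt_succ_iff.1 j.2).lt_or_eq with h | h
        · exact Submodule.subset_span ⟨⟨j, h⟩, rfl⟩
        · rw [h]; exact hxm
      obtain ⟨q, hq⟩ := (Submodule.mem_span_range_iff_exists_fun k).1 h2
      have h3 : Φ q = ∑ j, e j • (pPow p k)^[(j : ℕ)] x := hq
      rw [← h3] at h1 ⊢
      rw [← LinearMap.comp_apply, hlam, LinearMap.id_apply] at h1
      rw [h1, map_zero]
  -- The value `-1` at index `m` moves the top iterate to the other side of the relation; for `m =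
  -- 0` it also serves as the nonzero linear coefficient.
  refine ⟨m, x, Module.Basis.mk hli hWtop.ge,
    fun i => if h : i < m then d ⟨i, h⟩ else -1, fun i => by simp, ?_, by simp, ?_⟩
  · rcases Nat.eq_zero_or_pos m with h | h
    · simp [h]
    · simpa [h] using hd0 h
  · rw [pPoly, Finset.sum_range_succ, Finset.sum_range]
    simp [hd]

end CyclicVector

/-! ### Irreducible components through a point -/

section Components

open TopologicalSpace

/-- A nonempty open subset is dense in the irreducible set `C`, so the closed set `C'` contains `C`;
maximality finishes. -/
theorem eq_of_mem_irreducibleComponents_of_open_subset {X : Type*} [TopologicalSpace X]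
    {C C' W : Set X} (hC : C ∈ irreducibleComponents X) (hC' : C' ∈ irreducibleComponents X)
    (hW : IsOpen W) (hne : W.Nonempty) (hWC : W ⊆ C) (hWC' : W ⊆ C') : C = C' := by
  have h1 : C ⊆ C' := by
    have h : C ⊆ closure (C ∩ W) := subset_closure_inter_of_isPreirreducible_of_isOpen hC.1.2 hW
      (by rwa [Set.inter_eq_right.2 hWC])
    refine h.trans (closure_minimal ?_ (isClosed_of_mem_irreducibleComponents _ hC'))
    exact Set.inter_subset_right.trans hWC'
  exact h1.antisymm (hC.2 hC'.1 h1)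

/-- In a noetherian space every component contains a nonempty open set, which may be taken basic and
has `x` in its closure. Hypothesis `H` makes two such sets meet. -/
theorem eq_of_mem_irreducibleComponents_of_induced_zariski {k V : Type*} [Field k]
    [AddCommGroup V] [Module k V] {X : Type*} [tX : TopologicalSpace X] [NoetherianSpace X]
    {i : X → V} (hX : tX = TopologicalSpace.induced i (zariskiTopology k V)) {x : X}
    (H : ∀ f ∈ polyFunctions k V, ∀ g ∈ polyFunctions k V, x ∈ closure {y | f (i y) ≠ 0} →
      x ∈ closure {y | g (i y) ≠ 0} → ∃ y, f (i y) * g (i y) ≠ 0)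
    {C C' : Set X} (hC : C ∈ irreducibleComponents X) (hC' : C' ∈ irreducibleComponents X)
    (hx : x ∈ C) (hx' : x ∈ C') : C = C' := by
  have key : ∀ D ∈ irreducibleComponents X, x ∈ D → ∃ f ∈ polyFunctions k V,
      {y | f (i y) ≠ 0} ⊆ D ∧ x ∈ closure {y | f (i y) ≠ 0} := by
    intro D hD hxD
    obtain ⟨U, hU, ⟨z, hz⟩, hUD⟩ :=
      NoetherianSpace.exists_isOpen_nonempty_subset_irreducibleComponent D hD
    obtain ⟨f, hf, hfz, hfU⟩ := (isOpen_iff_of_induced_zariski hX).1 hU z hz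
    refine ⟨f, hf, fun y hy => hUD (hfU y hy), ?_⟩
    have h : D ⊆ closure (D ∩ {y | f (i y) ≠ 0}) := subset_closure_inter_of_isPreirreducible_of_isOpen hD.1.2
      (isOpen_ne_of_induced_zariski hX hf) ⟨z, hUD hz, hfz⟩
    exact closure_mono Set.inter_subset_right (h hxD)
  obtain ⟨f, hf, hfC, hxf⟩ := key C hC hx
  obtain ⟨g, hg, hgC, hxg⟩ := key C' hC' hx'
  obtain ⟨y, hy⟩ := H f hf g hg hxf hxg
  exact eq_of_mem_irreducibleComponents_of_open_subset hC hC'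
    ((isOpen_ne_of_induced_zariski hX hf).inter (isOpen_ne_of_induced_zariski hX hg))
    ⟨y, left_ne_zero_of_mul hy, right_ne_zero_of_mul hy⟩
    (fun z hz => hfC hz.1) (fun z hz => hgC hz.2)

end Components

/-! ### Embeddings of a torus -/

section Embeddings

open TopologicalSpace

variable {p : ℕ} {k : Type*} [Field k] [hp : Fact p.Prime]
variable {L : Type*} [LieRing L] [LieAlgebra k L] [RestrictedLieAlgebra p k L]

omit hp in
theorem iterate_pPow_eq_of_pPoly_eq_zero {r : ℕ} {c : ℕ → k} (hc : c r = -1) {x : L}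
    (hx : pPoly p (r + 1) c x = 0) :
    (pPow p k)^[r] x = ∑ i : Fin r, c i • (pPow p k)^[(i : ℕ)] x := by
  rw [pPoly, Finset.sum_range_succ, hc, neg_one_smul, Finset.sum_range] at hx
  exact (sub_eq_zero.1 (by rw [sub_eq_add_neg]; exact hx)).symm

section OneGenerator

variable {M : Type*} [LieRing M] [LieAlgebra k M] [RestrictedLieAlgebra p k M]
  {r : ℕ} (b : Module.Basis (Fin r) k M)

variable (p) in
/-- The linear map sending the basis element `b i` to `x^[p]^i`. -/
def iterateMap (x : L) : M →ₗ[k] L := ∑ i, (b.coord i).smulRight ((pPow p k)^[(i : ℕ)] x)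

omit hp [RestrictedLieAlgebra p k M] in
theorem iterateMap_basis (x : L) (i : Fin r) :
    iterateMap p b x (b i) = (pPow p k)^[(i : ℕ)] x := by
  simp [iterateMap, Finsupp.single_apply, ite_smul]

omit [RestrictedLieAlgebra p k M] in
theorem isPolyMap_iterateMap [Module.Finite k L] :
    IsPolyMap k (iterateMap p b : L → M →ₗ[k] L) := by
  have : (iterateMap p b : L → M →ₗ[k] L) =
      fun x => ∑ i, LinearMap.smulRightₗ (b.coord i) ((pPow p k)^[(i : ℕ)] x) := rfl
  rw [this]
  exact IsPolyMap.sum _ fun i _ => (LinearMap.isPolyMap _).comp (isPolyMap_iterate_pPow _)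

omit [RestrictedLieAlgebra p k M] in
theorem lie_iterateMap (x : L) (y z : M) : ⁅iterateMap p b x y, iterateMap p b x z⁆ = 0 := by
  simp only [iterateMap, LinearMap.sum_apply, LinearMap.smulRight_apply, sum_lie, lie_sum, smul_lie,
    lie_smul, lie_iterate_pPow (lie_self x), smul_zero, Finset.sum_const_zero]

/-- On commuting elements the `p`-map is additive and Frobenius-semilinear, so basis elements
suffice. Only the last one is not simply shifted; there the common relation of `h` and `x` is used.
-/
theorem iterateMap_pPow {h : M} (hb : ∀ i, b i = (pPow p k)^[(i : ℕ)] h) {c : ℕ → k}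
    (hc : c r = -1) (hch : pPoly p (r + 1) c h = 0) {x : L} (hx : pPoly p (r + 1) c x = 0) (y : M) :
    iterateMap p b x (pPow p k y) = pPow p k (iterateMap p b x y) := by
  have hbasis : ∀ i, iterateMap p b x (pPow p k (b i)) = (pPow p k)^[(i : ℕ) + 1] x := by
    intro i
    rw [hb, ← Function.iterate_succ_apply' (pPow p k)]
    rcases (Nat.succ_le_iff.2 i.2).lt_or_eq with hi | hi
    · exact (congrArg _ (hb ⟨_, hi⟩)).symm.trans (iterateMap_basis b x _)
    · change iterateMap p b x ((pPow p k)^[(i : ℕ).succ] h) = (pPow p k)^[(i : ℕ).succ] x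
      rw [hi, iterate_pPow_eq_of_pPoly_eq_zero hc hx, iterate_pPow_eq_of_pPoly_eq_zero hc hch, map_sum]
      refine Finset.sum_congr rfl fun j _ => ?_
      rw [map_smul, ← hb, iterateMap_basis]
  have hlie : ∀ i j : Fin r, ⁅b.repr y i • b i, b.repr y j • b j⁆ = 0 := by
    intro i j
    rw [smul_lie, lie_smul, hb, hb, lie_iterate_pPow (lie_self h), smul_zero, smul_zero]
  have hy := b.sum_repr y
  conv_lhs => rw [← hy]
  conv_rhs => rw [← hy]
  rw [pPow_sum_of_lie_eq_zero _ _ hlie, map_sum, map_sum, pPow_sum_of_lie_eq_zero]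
  · refine Finset.sum_congr rfl fun i _ => ?_
    rw [pPow_smul, map_smul, map_smul, pPow_smul, hbasis, iterateMap_basis,
      Function.iterate_succ_apply']
  · intro i j
    exact lie_iterateMap b x _ _

end OneGenerator

variable {t : RestrictedSubalgebra p k L}

omit hp in
theorem TorusPoint.iterate_pPow (φ : TorusPoint t) (i : ℕ) (x : t.toLieSubalgebra) :
    φ.toLieHom ((pPow p k)^[i] x) = (pPow p k)^[i] (φ.toLieHom x) := by
  induction i with
  | zero => rfl
  | succ i ih => simp only [Function.iterate_succ_apply']; rw [φ.map_pPow', ih]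

omit hp in
theorem TorusPoint.map_pPoly (φ : TorusPoint t) (n : ℕ) (c : ℕ → k) (x : t.toLieSubalgebra) :
    φ.toLieHom (pPoly p n c x) = pPoly p n c (φ.toLieHom x) := by
  simp only [pPoly, map_sum, map_smul, φ.iterate_pPow]

omit hp in
theorem TorusPoint.iterateMap_apply (φ : TorusPoint t) {r : ℕ}
    (b : Module.Basis (Fin r) k t.toLieSubalgebra) {h : t.toLieSubalgebra}
    (hb : ∀ i, b i = (pPow p k)^[(i : ℕ)] h) :
    iterateMap p b (φ.toLieHom h) = (φ.toLieHom : t.toLieSubalgebra →ₗ[k] L) := by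
  refine b.ext fun i => ?_
  rw [iterateMap_basis, ← φ.iterate_pPow, ← hb]
  rfl

omit hp in
theorem RestrictedSubalgebra.coe_iterate_pPow (i : ℕ) (x : t.toLieSubalgebra) :
    (((pPow p k)^[i] x : t.toLieSubalgebra) : L) = (pPow p k)^[i] (x : L) := by
  induction i with
  | zero => rfl
  | succ i ih => simp only [Function.iterate_succ_apply']; rw [coe_pPow, ih]

omit hp in
theorem RestrictedSubalgebra.isSemisimpleElement_iff (x : t.toLieSubalgebra) :
    IsSemisimpleElement p k x ↔ IsSemisimpleElement p k (x : L) := by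
  have : Submodule.span k (Set.range fun i : ℕ => (pPow p k)^[i + 1] (x : L)) =
      (Submodule.span k (Set.range fun i : ℕ => (pPow p k)^[i + 1] x)).map
        (t.toLieSubalgebra.toSubmodule.subtype) := by
    rw [Submodule.map_span, ← Set.range_comp]
    congr 2
    ext i
    exact (RestrictedSubalgebra.coe_iterate_pPow (i + 1) x).symm
  rw [IsSemisimpleElement, IsSemisimpleElement, this]
  exact (Function.Injective.mem_set_image Subtype.val_injective).symm

instance [Module.Finite k L] : NoetherianSpace (TorusPoint t) := noetherianSpace_induced_zariski _

/-- Evaluation at a generator `h` identifies embeddings with those zeros `x` of its `p`-polynomial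
for which `iterateMap p b x` is injective, so local irreducibility of the zero set transfers to the
space of embeddings. -/
theorem eq_of_mem_irreducibleComponents_torusPoint [IsAlgClosed k] [Module.Finite k L]
    (ht : t.IsTorus) {φ : TorusPoint t} {C C' : Set (TorusPoint t)}
    (hC : C ∈ irreducibleComponents (TorusPoint t))
    (hC' : C' ∈ irreducibleComponents (TorusPoint t)) (hφ : φ ∈ C) (hφ' : φ ∈ C') : C = C' := by
  have : Infinite k := IsAlgClosed.instInfinite
  obtain ⟨r, h, b, c, hb, hc0, hcr, hch⟩ := exists_cyclic_vector (p := p) (k := k)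
    (M := t.toLieSubalgebra) (fun x y => Subtype.ext (ht.1 x x.2 y y.2))
    (fun x => (RestrictedSubalgebra.isSemisimpleElement_iff x).2 (ht.2 x x.2))
  refine eq_of_mem_irreducibleComponents_of_induced_zariski (k := k)
    (V := t.toLieSubalgebra →ₗ[k] L) (i := fun φ => (φ.toLieHom : t.toLieSubalgebra →ₗ[k] L)) rfl
    ?_ hC hC' hφ hφ'
  intro f hf g hg hφf hφg
  by_contra! hfg
  obtain ⟨ρ, hρ⟩ := LinearMap.exists_leftInverse_of_injective
    (φ.toLieHom : t.toLieSubalgebra →ₗ[k] L) (LinearMap.ker_eq_bot.2 φ.injective')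
  -- A polynomial function nonzero at `φ` whose nonvanishing forces injectivity. Multiplying `f` by
  -- `s` discards the zeros of `P` that do not give embeddings.
  let s : (t.toLieSubalgebra →ₗ[k] L) → k := fun A => LinearMap.det (ρ.comp A)
  have hs : s ∈ polyFunctions k (t.toLieSubalgebra →ₗ[k] L) :=
    det_mem_polyFunctions _ (LinearMap.llcomp k t.toLieSubalgebra L t.toLieSubalgebra ρ).isPolyMap
  have hsφ : s (φ.toLieHom : t.toLieSubalgebra →ₗ[k] L) ≠ 0 := by
    change LinearMap.det (ρ.comp _) ≠ 0
    rw [hρ, LinearMap.det_id]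
    exact one_ne_zero
  have hsinj : ∀ A, s A ≠ 0 → Function.Injective A := by
    intro A hA
    have h1 : Function.Injective (ρ.comp A) := (LinearMap.equivOfDetNeZero _ hA).injective
    exact Function.Injective.of_comp (f := ρ) (by simpa using h1)
  have hΨ : IsPolyMap k (iterateMap p b : L → t.toLieSubalgebra →ₗ[k] L) := isPolyMap_iterateMap b
  have hΨmem : ∀ x : L, pPoly p (r + 1) c x = 0 → s (iterateMap p b x) ≠ 0 →
      ∃ ψ : TorusPoint t, (ψ.toLieHom : t.toLieSubalgebra →ₗ[k] L) = iterateMap p b x := by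
    intro x hx hsx
    refine ⟨{ toLinearMap := iterateMap p b x
              map_lie' := fun {y z} => ?_
              injective' := hsinj _ hsx
              map_pPow' := iterateMap_pPow b hb hcr hch hx }, rfl⟩
    have : ⁅y, z⁆ = 0 := Subtype.ext (ht.1 y y.2 z z.2)
    rw [this]
    exact (map_zero (iterateMap p b x)).trans (lie_iterateMap b x y z).symm
  have hzero : ∀ ψ : TorusPoint t, pPoly p (r + 1) c (ψ.toLieHom h) = 0 := by
    intro ψ
    rw [← ψ.map_pPoly, hch, map_zero]
  obtain ⟨u, hu, huφ, hor⟩ := pPoly_zeros_locally_irreducible (p := p) r c hc0 (hzero φ)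
    (hΨ.comp_mem (mul_mem hs hf)) (hΨ.comp_mem hg) (by
      intro x hx
      by_cases hsx : s (iterateMap p b x) = 0
      · simp [hsx]
      · obtain ⟨ψ, hψ⟩ := hΨmem x hx hsx
        have := hfg ψ
        simp only [Function.comp_apply, Pi.mul_apply, ← hψ, mul_assoc]
        rw [this, mul_zero])
  let w : (t.toLieSubalgebra →ₗ[k] L) → k := s * (u ∘ LinearMap.applyₗ h)
  have hopen : IsOpen {ψ : TorusPoint t | w (ψ.toLieHom : t.toLieSubalgebra →ₗ[k] L) ≠ 0} :=
    isOpen_ne_of_induced_zariski rfl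
      (mul_mem hs ((LinearMap.applyₗ h : (t.toLieSubalgebra →ₗ[k] L) →ₗ[k] L).isPolyMap.comp_mem hu))
  have hmem : φ ∈ {ψ : TorusPoint t | w (ψ.toLieHom : t.toLieSubalgebra →ₗ[k] L) ≠ 0} :=
    mul_ne_zero hsφ huφ
  rcases hor with hor | hor
  · obtain ⟨ψ, hψ, hψf⟩ := mem_closure_iff.1 hφf _ hopen hmem
    have h1 := hor _ (hzero ψ) (right_ne_zero_of_mul hψ)
    rw [Function.comp_apply, ψ.iterateMap_apply b hb] at h1
    exact mul_ne_zero (left_ne_zero_of_mul hψ) hψf h1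
  · obtain ⟨ψ, hψ, hψg⟩ := mem_closure_iff.1 hφg _ hopen hmem
    have h1 := hor _ (hzero ψ) (right_ne_zero_of_mul hψ)
    rw [Function.comp_apply, ψ.iterateMap_apply b hb] at h1
    exact hψg h1

end Embeddings

/-! ### Irreducible components and groups of homeomorphisms -/

section GroupTopology

open TopologicalSpace

theorem Homeomorph.image_mem_irreducibleComponents {X Y : Type*} [TopologicalSpace X]
    [TopologicalSpace Y] (e : X ≃ₜ Y) {C : Set X} (hC : C ∈ irreducibleComponents X) :
    e '' C ∈ irreducibleComponents Y := by
  refine ⟨hC.1.image e e.continuous.continuousOn, fun D hD hCD => ?_⟩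
  have h1 : C ⊆ e.symm '' D := by
    intro x hx
    exact ⟨e x, hCD ⟨x, hx, rfl⟩, e.symm_apply_apply x⟩
  have h2 := hC.2 (hD.image e.symm e.symm.continuous.continuousOn) h1
  intro y hy
  exact ⟨e.symm y, h2 ⟨y, hy, rfl⟩, e.apply_symm_apply y⟩

/-- Some point lies on a single irreducible component, and left translations carry any point to it.
Components are therefore disjoint and, being finitely many and closed, also open. -/
theorem isIrreducible_connectedComponent_one {G : Type*} [Group G] [TopologicalSpace G]
    [NoetherianSpace G] (hG : ∀ g : G, Continuous (g * · : G → G)) :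
    IsIrreducible (connectedComponent (1 : G)) := by
  let e : G → G ≃ₜ G := fun g =>
    { Equiv.mulLeft g with
      continuous_toFun := hG g
      continuous_invFun := hG g⁻¹ }
  let C₀ := irreducibleComponent (1 : G)
  have hC₀ : C₀ ∈ irreducibleComponents G := irreducibleComponent_mem_irreducibleComponents 1
  obtain ⟨U, hU, ⟨u, hu⟩, hUC⟩ :=
    NoetherianSpace.exists_isOpen_nonempty_subset_irreducibleComponent C₀ hC₀
  have hthrough : ∀ D ∈ irreducibleComponents G, u ∈ D → D = C₀ := by
    intro D hD huD
    have h := subset_closure_inter_of_isPreirreducible_of_isOpen hD.1.2 hU ⟨u, huD, hu⟩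
    have h1 : D ⊆ C₀ := h.trans (closure_minimal (Set.inter_subset_right.trans hUC)
      (isClosed_of_mem_irreducibleComponents _ hC₀))
    exact h1.antisymm (hD.2 hC₀.1 h1)
  have huniq : ∀ D ∈ irreducibleComponents G, ∀ D' ∈ irreducibleComponents G, ∀ a, a ∈ D → a ∈ D' →
      D = D' := by
    intro D hD D' hD' a ha ha'
    have h1 : e (u * a⁻¹) a = u := inv_mul_cancel_right u a
    refine (e (u * a⁻¹)).injective.image_injective ?_
    rw [hthrough _ ((e (u * a⁻¹)).image_mem_irreducibleComponents hD) ⟨a, ha, h1⟩,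
      hthrough _ ((e (u * a⁻¹)).image_mem_irreducibleComponents hD') ⟨a, ha', h1⟩]
  have hcompl : C₀ᶜ = ⋃₀ (irreducibleComponents G \ {C₀}) := by
    ext a
    constructor
    · intro ha
      refine ⟨irreducibleComponent a, ⟨irreducibleComponent_mem_irreducibleComponents a, ?_⟩,
        mem_irreducibleComponent⟩
      intro h
      exact ha (h ▸ mem_irreducibleComponent)
    · rintro ⟨D, ⟨hD, hne⟩, haD⟩ ha
      exact hne (huniq D hD C₀ hC₀ a haD ha)
  have hclopen : IsClopen C₀ := by
    refine ⟨isClosed_of_mem_irreducibleComponents _ hC₀, ?_⟩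
    rw [← isClosed_compl_iff, hcompl, Set.sUnion_eq_biUnion]
    exact NoetherianSpace.finite_irreducibleComponents.sdiff.isClosed_biUnion
      fun D hD => isClosed_of_mem_irreducibleComponents D hD.1
  have : connectedComponent (1 : G) = C₀ :=
    (hclopen.connectedComponent_subset mem_irreducibleComponent).antisymm
      (isIrreducible_irreducibleComponent.isPreirreducible.isPreconnected.subset_connectedComponent
        mem_irreducibleComponent)
  rw [this]
  exact hC₀.1

theorem smul_mem_irreducibleComponents {G X : Type*} [Group G] [MulAction G X] [TopologicalSpace X]
    [ContinuousConstSMul G X] (g : G) {C : Set X} (hC : C ∈ irreducibleComponents X) :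
    g • C ∈ irreducibleComponents X :=
  (Homeomorph.smul g).image_mem_irreducibleComponents hC

/-- A connected set of homeomorphisms fixes each irreducible component of a noetherian space. -/
theorem smul_irreducibleComponent_eq_of_mem_connectedComponent_one {G X : Type*} [Group G]
    [MulAction G X] [TopologicalSpace G] [TopologicalSpace X] [NoetherianSpace X]
    [ContinuousConstSMul G X] (horb : ∀ x : X, Continuous fun g : G => g • x) {C : Set X}
    (hC : C ∈ irreducibleComponents X) {g : G} (hg : g ∈ connectedComponent (1 : G)) :
    g • C = C := by
  have heq : ∀ (g : G), ∀ D ∈ irreducibleComponents X, (∀ x ∈ C, g • x ∈ D) → g • C = D := by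
    intro g D hD h
    have h1 : g • C ⊆ D := by
      rintro _ ⟨x, hx, rfl⟩
      exact h x hx
    exact h1.antisymm ((smul_mem_irreducibleComponents g hC).2 hD.1 h1)
  -- The sets of `g` carrying `C` into a given component are closed. Those for components other than
  -- `C` are finitely many and cover the complement of `S C`, so `S C` is clopen and contains `1`.
  let S : Set X → Set G := fun D => {g | ∀ x ∈ C, g • x ∈ D}
  have hS : ∀ D ∈ irreducibleComponents X, IsClosed (S D) := by
    intro D hD
    have : S D = ⋂ x ∈ C, (fun g : G => g • x) ⁻¹' D := by ext; simp [S]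
    rw [this]
    exact isClosed_biInter fun x _ => (isClosed_of_mem_irreducibleComponents D hD).preimage (horb x)
  have hcompl : (S C)ᶜ = ⋃ D ∈ irreducibleComponents X \ {C}, S D := by
    ext g
    simp only [Set.mem_compl_iff, Set.mem_iUnion, exists_prop]
    constructor
    · intro hg
      refine ⟨g • C, ⟨smul_mem_irreducibleComponents g hC, fun h => hg fun x hx => ?_⟩,
        fun x hx => Set.smul_mem_smul_set hx⟩
      rw [Set.mem_singleton_iff] at h
      rw [← h]
      exact Set.smul_mem_smul_set hx
    · rintro ⟨D, ⟨hD, hne⟩, hgD⟩ hgC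
      exact hne ((heq g D hD hgD).symm.trans (heq g C hC hgC))
  have hclopen : IsClopen (S C) := by
    refine ⟨hS C hC, ?_⟩
    rw [← isClosed_compl_iff, hcompl]
    exact NoetherianSpace.finite_irreducibleComponents.sdiff.isClosed_biUnion fun D hD => hS D hD.1
  exact heq g C hC (hclopen.connectedComponent_subset (fun x hx => by rwa [one_smul]) hg)

end GroupTopology

/-! ### Chevalley's theorem for points -/

section Chevalley

/-- By Chevalley the image of the basic open set of `δ` is constructible. The piece containing the
image of the generic point has its closed conditions in `ker θ`, so only its inequation `f ∉ P`
restricts primes above `ker θ`. -/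
theorem exists_notMem_ker_forall_prime_exists_comap_eq {R B : Type*} [CommRing R]
    [IsNoetherianRing R] [CommRing B] [IsDomain B] (θ : R →+* B) (hθ : θ.FiniteType) {δ : B}
    (hδ : δ ≠ 0) : ∃ f, θ f ≠ 0 ∧ ∀ P : Ideal R, P.IsPrime → RingHom.ker θ ≤ P → f ∉ P →
      ∃ Q : Ideal B, Q.IsPrime ∧ δ ∉ Q ∧ Q.comap θ = P := by
  have hcons := PrimeSpectrum.isConstructible_comap_image (f := θ)
    (RingHom.FinitePresentation.of_finiteType.1 hθ)
    (s := (PrimeSpectrum.basicOpen δ : Set (PrimeSpectrum B)))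
    PrimeSpectrum.isConstructible_basicOpen
  obtain ⟨S, hS⟩ := PrimeSpectrum.exists_constructibleSetData_iff.2 hcons
  have hgen : PrimeSpectrum.comap θ ⊥ ∈ S.toSet := by
    rw [hS]
    exact ⟨⊥, hδ, rfl⟩
  simp only [PrimeSpectrum.ConstructibleSetData.toSet, Set.mem_iUnion] at hgen
  obtain ⟨C, hCS, hC⟩ := hgen
  rw [PrimeSpectrum.BasicConstructibleSetData.toSet] at hC
  obtain ⟨hg, hf⟩ := hC
  rw [PrimeSpectrum.mem_zeroLocus] at hg hf
  refine ⟨C.f, fun h => hf ?_, fun P hP hker hfP => ?_⟩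
  · rw [Set.singleton_subset_iff]
    exact h
  · have hmem : (⟨P, hP⟩ : PrimeSpectrum R) ∈ S.toSet := by
      simp only [PrimeSpectrum.ConstructibleSetData.toSet, Set.mem_iUnion]
      refine ⟨C, hCS, ?_, ?_⟩
      · rw [PrimeSpectrum.mem_zeroLocus]
        exact fun x hx => hker (hg hx)
      · rw [PrimeSpectrum.mem_zeroLocus, Set.singleton_subset_iff]
        exact hfP
    rw [hS] at hmem
    obtain ⟨Q, hQ, hQP⟩ := hmem
    exact ⟨Q.asIdeal, Q.2, hQ, congrArg PrimeSpectrum.asIdeal hQP⟩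

variable {k : Type*} [Field k] [IsAlgClosed k] {V W : Type*} [AddCommGroup V] [Module k V]
  [AddCommGroup W] [Module k W] [Module.Finite k V] [Module.Finite k W]

/-- The image of an irreducible locally closed set under a linear map contains a nonempty open
subset of its closure. -/
theorem exists_ne_zero_forall_mem_image {S : Set V}
    (hne : S.Nonempty) (hirr : ∀ f ∈ polyFunctions k V, ∀ g ∈ polyFunctions k V,
      (∀ v ∈ S, f v * g v = 0) → (∀ v ∈ S, f v = 0) ∨ ∀ v ∈ S, g v = 0)
    {δ : V → k} (hδ : δ ∈ polyFunctions k V) (hSδ : ∀ v ∈ S, δ v ≠ 0)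
    (hclosed : ∀ v, δ v ≠ 0 → (∀ f ∈ polyFunctions k V, (∀ u ∈ S, f u = 0) → f v = 0) → v ∈ S)
    (T : V →ₗ[k] W) :
    ∃ f ∈ polyFunctions k W, (∃ v ∈ S, f (T v) ≠ 0) ∧ ∀ w, f w ≠ 0 →
      (∀ g ∈ polyFunctions k W, (∀ v ∈ S, g (T v) = 0) → g w = 0) → ∃ v ∈ S, T v = w := by
  let I : Ideal (polyFunctions k V) := ⨅ v ∈ S, RingHom.ker (polyEval (k := k) v)
  have hI : ∀ f, f ∈ I ↔ ∀ v ∈ S, (f : V → k) v = 0 := by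
    intro f
    simp [I, Submodule.mem_iInf, RingHom.mem_ker]
  obtain ⟨v₀, hv₀⟩ := hne
  have hIprime : I.IsPrime := by
    refine ⟨fun h => ?_, fun {f g} hfg => ?_⟩
    · have h1 := (hI 1).1 (h ▸ trivial) v₀ hv₀
      exact one_ne_zero h1
    · rw [hI] at hfg
      rw [hI, hI]
      exact hirr f f.2 g g.2 hfg
  let θ : polyFunctions k W →+* polyFunctions k V ⧸ I :=
    (Ideal.Quotient.mk I).comp (T.isPolyMap.comap : polyFunctions k W →+* polyFunctions k V)
  have hθ : RingHom.FiniteType (A := polyFunctions k W) (B := polyFunctions k V ⧸ I) θ := by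
    refine RingHom.FiniteType.of_comp_finiteType (f := algebraMap k (polyFunctions k W)) ?_
    have h1 : (algebraMap k (polyFunctions k V)).FiniteType :=
      RingHom.finiteType_algebraMap.2 inferInstance
    have h2 : θ.comp (algebraMap k (polyFunctions k W)) =
        (Ideal.Quotient.mk I).comp (algebraMap k (polyFunctions k V)) := rfl
    rw [h2]
    exact RingHom.FiniteType.comp_surjective h1 Ideal.Quotient.mk_surjective
  have hθ0 : ∀ g, θ g = 0 ↔ ∀ v ∈ S, (g : W → k) (T v) = 0 := by
    intro g
    change Ideal.Quotient.mk I _ = 0 ↔ _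
    rw [Ideal.Quotient.eq_zero_iff_mem, hI]
    rfl
  have hδ0 : Ideal.Quotient.mk I ⟨δ, hδ⟩ ≠ 0 := by
    rw [Ne, Ideal.Quotient.eq_zero_iff_mem, hI]
    exact fun h => hSδ v₀ hv₀ (h v₀ hv₀)
  obtain ⟨f, hf, H⟩ := exists_notMem_ker_forall_prime_exists_comap_eq
    (B := polyFunctions k V ⧸ I) θ hθ (δ := Ideal.Quotient.mk I ⟨δ, hδ⟩) hδ0
  refine ⟨f, f.2, ?_, fun w hfw hw => ?_⟩
  · rw [Ne, hθ0] at hf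
    push Not at hf
    exact hf
  · obtain ⟨Q, hQ, hδQ, hQw⟩ := H (RingHom.ker (polyEval (k := k) w)) (RingHom.ker_isPrime _)
      (fun g hg => hw g g.2 ((hθ0 g).1 hg)) hfw
    let Q' := Q.comap (Ideal.Quotient.mk I)
    have hQ' : Q'.IsPrime := Ideal.comap_isPrime _ _
    -- Chevalley only yields a prime `Q'`. In a Jacobson ring some maximal ideal above it still
    -- avoids `δ`; the corresponding point lies in `S` and maps to `w`.
    have hδQ' : (⟨δ, hδ⟩ : polyFunctions k V) ∉ Q'.jacobson := by
      rw [IsJacobsonRing.out inferInstance hQ'.isRadical]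
      exact hδQ
    rw [Ideal.jacobson, Ideal.mem_sInf] at hδQ'
    push Not at hδQ'
    obtain ⟨M, ⟨hQM, hM⟩, hδM⟩ := hδQ'
    obtain ⟨v, rfl⟩ := exists_eq_ker_polyEval M
    refine ⟨v, hclosed v hδM fun g hg hgS => ?_, ?_⟩
    · have h1 : (⟨g, hg⟩ : polyFunctions k V) ∈ I := (hI _).2 hgS
      refine hQM (?_ : (⟨g, hg⟩ : polyFunctions k V) ∈ Q')
      rw [Ideal.mem_comap, Ideal.Quotient.eq_zero_iff_mem.2 h1]
      exact Q.zero_mem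
    · rw [← sub_eq_zero, ← Module.forall_dual_apply_eq_zero_iff k]
      intro l
      have h1 : polyLinear l - algebraMap k _ (l w) ∈ RingHom.ker (polyEval (k := k) w) := by
        rw [RingHom.mem_ker, map_sub]
        exact sub_self (l w)
      rw [← hQw] at h1
      have h2 : T.isPolyMap.comap (polyLinear l - algebraMap k _ (l w)) ∈ Q' := h1
      have h3 : l (T v) - l w = 0 := hQM h2
      rw [map_sub, h3]

end Chevalley

/-! ### Orbits of the automorphism group -/

section Orbits

open TopologicalSpace

variable {p : ℕ} {k : Type*} [Field k]
variable {L : Type*} [LieRing L] [LieAlgebra k L] [RestrictedLieAlgebra p k L]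

instance [Module.Finite k L] : NoetherianSpace (AutP p k L) := noetherianSpace_induced_zariski _

/-- Compatibility with bracket and `p`-map is polynomial in `A`, so it passes from the group to `A`;
the identity component is closed in `Aut_p(L)`. Thus `G` is closed in the locus `det ≠ 0`, as
Chevalley's theorem requires. -/
theorem mem_autPConn_of_forall_polyFunctions [hp : Fact p.Prime] [Module.Finite k L] {A : L →ₗ[k] L}
    (hdet : LinearMap.det A ≠ 0) (hA : ∀ f ∈ polyFunctions k (L →ₗ[k] L),
      (∀ g ∈ AutPConn p k L, f ((g : L ≃ₗ[k] L) : L →ₗ[k] L) = 0) → f A = 0) :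
    ∃ g ∈ AutPConn p k L, ((g : L ≃ₗ[k] L) : L →ₗ[k] L) = A := by
  let a : L ≃ₗ[k] L := LinearMap.equivOfDetNeZero A hdet
  have hev : ∀ x : L, IsPolyMap k (fun B : L →ₗ[k] L => B x) := fun x =>
    (LinearMap.applyₗ x : (L →ₗ[k] L) →ₗ[k] L).isPolyMap
  have hmem : a ∈ AutP p k L := by
    constructor
    · intro x y
      rw [← sub_eq_zero, ← Module.forall_dual_apply_eq_zero_iff k]
      intro l
      have h1 : IsPolyMap k (fun B : L →ₗ[k] L => B ⁅x, y⁆ + (-1 : k) • ⁅B x, B y⁆) :=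
        (hev _).add (((CoordsIn.of_isPolyMap (hev x)).lie
          (CoordsIn.of_isPolyMap (hev y))).isPolyMap.const_smul _)
      have h2 := hA _ (h1 l) fun g _ => by
        change l (g.1 ⁅x, y⁆ + (-1 : k) • ⁅g.1 x, g.1 y⁆) = 0
        rw [g.2.1 x y, neg_one_smul, add_neg_cancel, map_zero]
      rw [sub_eq_add_neg, ← neg_one_smul k]
      exact h2
    · intro x
      rw [← sub_eq_zero, ← Module.forall_dual_apply_eq_zero_iff k]
      intro l
      have h1 : IsPolyMap k (fun B : L →ₗ[k] L => B (pPow p k x) + (-1 : k) • pPow p k (B x)) :=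
        (hev _).add ((isPolyMap_pPow.comp (hev x)).const_smul _)
      have h2 := hA _ (h1 l) fun g _ => by
        change l (g.1 (pPow p k x) + (-1 : k) • pPow p k (g.1 x)) = 0
        rw [g.2.2 x, neg_one_smul, add_neg_cancel, map_zero]
      rw [sub_eq_add_neg, ← neg_one_smul k]
      exact h2
  refine ⟨⟨a, hmem⟩, ?_, rfl⟩
  have hcl : (⟨a, hmem⟩ : AutP p k L) ∈ closure (connectedComponent 1) := by
    rw [mem_closure_iff_of_induced_zariski (k := k) (V := L →ₗ[k] L)
      (i := fun g : AutP p k L => ((g : L ≃ₗ[k] L) : L →ₗ[k] L)) rfl]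
    exact fun f hf h => hA f hf h
  rwa [isClosed_connectedComponent.closure_eq] at hcl

variable {t : RestrictedSubalgebra p k L}

instance : ContinuousConstSMul (AutP p k L) (TorusPoint t) where
  continuous_const_smul g := by
    let : TopologicalSpace (t.toLieSubalgebra →ₗ[k] L) := zariskiTopology k _
    have h₀ : Continuous fun φ : TorusPoint t => (φ.toLieHom : t.toLieSubalgebra →ₗ[k] L) :=
      continuous_induced_dom
    refine continuous_induced_rng.2 ?_
    exact (continuous_zariski (LinearMap.llcomp k t.toLieSubalgebra L L
      ((g : L ≃ₗ[k] L) : L →ₗ[k] L))).comp h₀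

instance : ContinuousConstSMul (AutP p k t.toLieSubalgebra) (TorusPoint t) where
  continuous_const_smul h := by
    let : TopologicalSpace (t.toLieSubalgebra →ₗ[k] L) := zariskiTopology k _
    have h₀ : Continuous fun φ : TorusPoint t => (φ.toLieHom : t.toLieSubalgebra →ₗ[k] L) :=
      continuous_induced_dom
    refine continuous_induced_rng.2 ?_
    exact (continuous_zariski (LinearMap.lcomp k L
      ((h⁻¹ : AutP p k t.toLieSubalgebra) :
        t.toLieSubalgebra ≃ₗ[k] t.toLieSubalgebra).toLinearMap)).comp h₀

theorem TorusPoint.continuous_smul_left (φ : TorusPoint t) :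
    Continuous fun g : AutP p k L => g • φ := by
  let : TopologicalSpace (L →ₗ[k] L) := zariskiTopology k _
  let : TopologicalSpace (t.toLieSubalgebra →ₗ[k] L) := zariskiTopology k _
  have h₀ : Continuous fun g : AutP p k L => ((g : L ≃ₗ[k] L) : L →ₗ[k] L) :=
    continuous_induced_dom
  refine continuous_induced_rng.2 ?_
  exact (continuous_zariski (LinearMap.lcomp k L
    (φ.toLieHom : t.toLieSubalgebra →ₗ[k] L))).comp h₀

instance : SMulCommClass (AutP p k t.toLieSubalgebra) (AutP p k L) (TorusPoint t) where
  smul_comm _ _ _ := TorusPoint.ext' fun _ => rfl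

/-- Two orbits of `Aut_p(L)°` with the same closure coincide. -/
theorem mem_orbit_of_closure_orbit_eq [Fact p.Prime] [IsAlgClosed k] [Module.Finite k L]
    {φ ψ : TorusPoint t} (h : closure (MulAction.orbit (AutPConn p k L) φ) =
      closure (MulAction.orbit (AutPConn p k L) ψ)) : ψ ∈ MulAction.orbit (AutPConn p k L) φ := by
  let i : TorusPoint t → (t.toLieSubalgebra →ₗ[k] L) := fun φ => φ.toLieHom
  let S : Set (L →ₗ[k] L) :=
    (fun g : AutP p k L => ((g : L ≃ₗ[k] L) : L →ₗ[k] L)) '' connectedComponent 1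
  have hirr := isIrreducible_connectedComponent_one (AutP.continuous_mul_left (p := p) (k := k) (L := L))
  obtain ⟨f, hf, ⟨_, ⟨g, hg, rfl⟩, hfg⟩, H⟩ := exists_ne_zero_forall_mem_image (k := k) (S := S)
    (δ := fun A => LinearMap.det A) (hirr.1.image _) (by
      intro f hf g hg hfg
      by_contra! hne
      obtain ⟨⟨_, ⟨a, ha, rfl⟩, hfa⟩, ⟨_, ⟨b, hb, rfl⟩, hgb⟩⟩ := hne
      obtain ⟨c, hc, hfc, hgc⟩ := hirr.2 _ _ (isOpen_ne_of_induced_zariski rfl hf)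
        (isOpen_ne_of_induced_zariski rfl hg) ⟨a, ha, hfa⟩ ⟨b, hb, hgb⟩
      exact mul_ne_zero hfc hgc (hfg _ ⟨c, hc, rfl⟩))
    (det_mem_polyFunctions _ (LinearMap.id : (L →ₗ[k] L) →ₗ[k] _).isPolyMap)
    (by
      rintro _ ⟨g, -, rfl⟩
      exact (LinearEquiv.isUnit_det' (g : L ≃ₗ[k] L)).ne_zero)
    (by
      intro A hA hAS
      obtain ⟨g, hg, rfl⟩ := mem_autPConn_of_forall_polyFunctions (p := p) hA
        fun f hf h => hAS f hf (by rintro _ ⟨g, hg, rfl⟩; exact h g hg)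
      exact ⟨g, hg, rfl⟩)
    (LinearMap.lcomp k L (i φ))
  have h1 : g • φ ∈ closure (MulAction.orbit (AutPConn p k L) ψ) := by
    rw [← h]
    exact subset_closure ⟨⟨g, hg⟩, rfl⟩
  -- The orbit of `φ` contains the part of its closure where `f ≠ 0`. This part is met by the orbit
  -- of `ψ`, which is dense in the same closure.
  obtain ⟨_, hfb, ⟨b, rfl⟩⟩ := mem_closure_iff.1 h1 {χ | f (i χ) ≠ 0}
    (isOpen_ne_of_induced_zariski rfl hf) hfg
  have h2 : b • ψ ∈ closure (MulAction.orbit (AutPConn p k L) φ) := by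
    rw [h]
    exact subset_closure ⟨b, rfl⟩
  rw [mem_closure_iff_of_induced_zariski (i := i) rfl] at h2
  obtain ⟨_, ⟨c, hc, rfl⟩, hcb⟩ := H (i (b • ψ)) hfb fun q hq hqS => h2 q hq (by
    rintro _ ⟨c, rfl⟩
    exact hqS _ ⟨c, c.2, rfl⟩)
  have h3 : (⟨c, hc⟩ : AutPConn p k L) • φ = b • ψ :=
    TorusPoint.ext' fun x => LinearMap.congr_fun hcb x
  refine ⟨b⁻¹ * ⟨c, hc⟩, ?_⟩
  change (b⁻¹ * ⟨c, hc⟩ : AutPConn p k L) • φ = ψ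
  rw [mul_smul, h3, inv_smul_smul]

end Orbits

/-! ### The homomorphism `Θ_φ`: target, kernel and image -/

section Main

variable {p : ℕ} {k : Type*} [Field k] [hp : Fact p.Prime] [IsAlgClosed k]
variable {L : Type*} [LieRing L] [LieAlgebra k L] [Module.Finite k L] [RestrictedLieAlgebra p k L]
variable {t : RestrictedSubalgebra p k L}

omit hp [IsAlgClosed k] [Module.Finite k L] in
theorem torusComponent_mem_irreducibleComponents :
    torusComponent t ∈ irreducibleComponents (TorusPoint t) :=
  irreducibleComponent_mem_irreducibleComponents _

omit hp [IsAlgClosed k] in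
theorem smul_torusComponent (g : AutPConn p k L) :
    (g : AutP p k L) • torusComponent t = torusComponent t :=
  smul_irreducibleComponent_eq_of_mem_connectedComponent_one TorusPoint.continuous_smul_left
    torusComponent_mem_irreducibleComponents g.2

omit hp [IsAlgClosed k] in
theorem smul_mem_torusComponent {φ : TorusPoint t} (hφ : φ ∈ torusComponent t)
    (g : AutPConn p k L) : (g : AutP p k L) • φ ∈ torusComponent t := by
  rw [← smul_torusComponent g]
  exact Set.smul_mem_smul_set hφ

omit hp [IsAlgClosed k] in
theorem orbitClosure_eq_closure {φ : TorusPoint t} (hφ : φ ∈ torusComponent t) :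
    orbitClosure φ = closure (MulAction.orbit (AutPConn p k L) φ) := by
  have hcl : IsClosed (torusComponent t) := isClosed_irreducibleComponent
  rw [orbitClosure, ← hcl.isClosedEmbedding_subtypeVal.closure_image_eq]
  congr 1
  ext ψ
  constructor
  · rintro ⟨χ, hχ, rfl⟩
    exact hχ
  · rintro ⟨g, rfl⟩
    exact ⟨⟨_, smul_mem_torusComponent hφ g⟩, ⟨g, rfl⟩, rfl⟩

omit hp [IsAlgClosed k] [Module.Finite k L] in
theorem smul_orbit_autPConn (h : AutP p k t.toLieSubalgebra) (φ : TorusPoint t) :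
    h • MulAction.orbit (AutPConn p k L) φ = MulAction.orbit (AutPConn p k L) (h • φ) := by
  ext ψ
  constructor
  · rintro ⟨_, ⟨g, rfl⟩, rfl⟩
    exact ⟨g, (smul_comm h (g : AutP p k L) φ).symm⟩
  · rintro ⟨g, rfl⟩
    exact ⟨_, ⟨g, rfl⟩, smul_comm h (g : AutP p k L) φ⟩

omit hp [IsAlgClosed k] [Module.Finite k L] in
-- Both sides are `g ∘ φ`; this converts the action of `Θ(g)` at `φ` into that of the connected
-- group.
theorem TorusPoint.theta_inv_smul (φ : TorusPoint t) (n : normalizerG p k φ.image) :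
    (φ.theta n)⁻¹ • φ = ((n : AutPConn p k L) : AutP p k L) • φ := by
  refine TorusPoint.ext' fun x => ?_
  change φ.toLieHom ((((φ.theta n)⁻¹⁻¹ : AutP p k t.toLieSubalgebra) :
    t.toLieSubalgebra ≃ₗ[k] t.toLieSubalgebra) x) = _
  rw [inv_inv]
  exact φ.apply_conj n x

/-- The translate of the component by `Θ(g)⁻¹` is a component meeting the original one in `g • φ`,
so uniqueness of the component through a point applies. -/
theorem TorusPoint.theta_mem_toralStabilizer (ht : t.IsTorus) {φ : TorusPoint t}
    (hφ : φ ∈ torusComponent t) (n : normalizerG p k φ.image) : φ.theta n ∈ toralStabilizer t := by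
  rw [← inv_mem_iff]
  refine eq_of_mem_irreducibleComponents_torusPoint ht
    (smul_mem_irreducibleComponents _ torusComponent_mem_irreducibleComponents)
    torusComponent_mem_irreducibleComponents (φ := (φ.theta n)⁻¹ • φ) (Set.smul_mem_smul_set hφ) ?_
  rw [φ.theta_inv_smul]
  exact smul_mem_torusComponent hφ _

omit hp [IsAlgClosed k] in
theorem TorusPoint.theta_smul_orbitClosure {φ : TorusPoint t}
    (hφ : φ ∈ torusComponent t) (n : normalizerG p k φ.image) :
    φ.theta n • orbitClosure φ = orbitClosure φ := by
  rw [eq_comm, ← inv_smul_eq_iff, orbitClosure_eq_closure hφ, ← closure_smul, smul_orbit_autPConn,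
    φ.theta_inv_smul]
  exact congrArg closure (MulAction.orbit_smul (n : AutPConn p k L) φ)

/-- Equal closures give equal orbits, hence some `g` in `G` with `g ∘ φ = φ ∘ h`; such a `g`
normalizes the image. -/
theorem TorusPoint.exists_theta_eq {φ : TorusPoint t} (hφ : φ ∈ torusComponent t)
    (h : AutP p k t.toLieSubalgebra) (hh : h • orbitClosure φ = orbitClosure φ) :
    ∃ n, φ.theta n = h := by
  have h1 : closure (MulAction.orbit (AutPConn p k L) φ) =
      closure (MulAction.orbit (AutPConn p k L) (h⁻¹ • φ)) := by
    rw [← smul_orbit_autPConn, closure_smul, eq_inv_smul_iff, ← orbitClosure_eq_closure hφ, hh]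
  obtain ⟨g, hg⟩ := mem_orbit_of_closure_orbit_eq h1
  have hgx : ∀ x, ((g : AutP p k L) : L ≃ₗ[k] L) (φ.toLieHom x) =
      φ.toLieHom ((h : t.toLieSubalgebra ≃ₗ[k] t.toLieSubalgebra) x) := by
    intro x
    have h2 : ((g : AutP p k L) : L ≃ₗ[k] L) (φ.toLieHom x) =
        φ.toLieHom (((h⁻¹⁻¹ : AutP p k t.toLieSubalgebra) :
          t.toLieSubalgebra ≃ₗ[k] t.toLieSubalgebra) x) :=
      congrArg (fun χ : TorusPoint t => χ.toLieHom x) hg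
    rwa [inv_inv] at h2
  have hgN : g ∈ normalizerG p k φ.image := by
    refine le_antisymm ?_ ?_
    · rintro _ ⟨_, ⟨x, rfl⟩, rfl⟩
      exact ⟨_, (hgx x).symm⟩
    · rintro _ ⟨x, rfl⟩
      refine ⟨_, ⟨(h : t.toLieSubalgebra ≃ₗ[k] t.toLieSubalgebra).symm x, rfl⟩, ?_⟩
      refine (hgx _).trans ?_
      rw [LinearEquiv.apply_symm_apply]
      rfl
  refine ⟨⟨g, hgN⟩, Subtype.ext (LinearEquiv.ext fun x => φ.injective' ?_)⟩
  exact (φ.apply_conj ⟨g, hgN⟩ x).trans (hgx x)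

omit hp [IsAlgClosed k] [Module.Finite k L] in
theorem TorusPoint.theta_eq_one_iff (φ : TorusPoint t) (n : normalizerG p k φ.image) :
    φ.theta n = 1 ↔ n ∈ (centralizerG p k φ.image).subgroupOf (normalizerG p k φ.image) := by
  constructor
  · rintro h _ ⟨x, rfl⟩
    refine (φ.apply_conj n x).symm.trans ?_
    exact congrArg (fun a : AutP p k t.toLieSubalgebra =>
      φ.toLieHom ((a : t.toLieSubalgebra ≃ₗ[k] t.toLieSubalgebra) x)) h
  · intro h
    refine Subtype.ext (LinearEquiv.ext fun x => φ.injective' ?_)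
    exact (φ.apply_conj n x).trans (h _ ⟨x, rfl⟩)

end Main

end

theorem theorem2p3 (p : ℕ) [Fact p.Prime] (hp : 3 ≤ p)
    (k : Type*) [Field k] [IsAlgClosed k] [CharP k p]
    (L : Type*) [LieRing L] [LieAlgebra k L] [Module.Finite k L] [RestrictedLieAlgebra p k L]
    (t : RestrictedSubalgebra p k L) (ht : t.IsTorusOfMaximalDim)
    (φ : TorusPoint t) (hφ : φ ∈ torusComponent t) :
    ∃ e : WeylGroup p k φ.image ≃* orbitClosureStabilizer φ,
      ∀ g : normalizerG p k φ.image,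
        ((e (QuotientGroup.mk g) : toralStabilizer t) : AutP p k t.toLieSubalgebra) =
          φ.theta g := by
  let Θ : normalizerG p k φ.image →* orbitClosureStabilizer φ :=
    (φ.theta.codRestrict (toralStabilizer t) (φ.theta_mem_toralStabilizer ht.1 hφ)).codRestrict
      (orbitClosureStabilizer φ) (φ.theta_smul_orbitClosure hφ)
  have hker : (centralizerG p k φ.image).subgroupOf (normalizerG p k φ.image) = Θ.ker := by
    ext n
    rw [← φ.theta_eq_one_iff, MonoidHom.mem_ker]
    exact ⟨fun h => Subtype.ext (Subtype.ext h), fun h => congrArg (fun a : orbitClosureStabilizer φ =>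
      ((a : toralStabilizer t) : AutP p k t.toLieSubalgebra)) h⟩
  have hsurj : Function.Surjective Θ := by
    rintro ⟨⟨h, hS⟩, hcl⟩
    obtain ⟨n, hn⟩ := φ.exists_theta_eq hφ h hcl
    exact ⟨n, Subtype.ext (Subtype.ext hn)⟩
  exact ⟨(QuotientGroup.quotientMulEquivOfEq hker).trans
    (QuotientGroup.quotientKerEquivOfSurjective Θ hsurj), fun _ => rfl⟩
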